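/- Let $M$ be a smooth manifold of dimension $2m+1$ without boundary, and let $\xi_0$ be a cooriented contact structure on $M$: $\xi_0=\ker\alpha$ for a smooth $1$-form $\alpha$ with $\alpha\wedge(d\alpha)^m$ nowhere zero, where $\alpha$ is determined up to multiplication by a positive function. Let $\mathcal C(M,\xi_0)$ be the space of cooriented contact structures on $M$ that are isotopic to $\xi_0$ (carried to it, with coorientation, by the time-one map of a smooth isotopy of $M$ starting at the identity), with the $C^\infty$ topology (convergence of all derivatives, uniformly on compact sets). For $z=(e_0,e_1,e_2)\in S^2\subset\mathbb R^3$ let $L_z$ be the left multiplication by the imaginary quaternion $e_0i+e_1j+e_2k$ on $\mathbb H^{n+1}=\mathbb H\oplus\mathbb H^n$. Regard $\mathbb R^{4n+3}$ as $\operatorname{Im}\mathbb H\oplus\mathbb H^n$, the orthogonal complement of $\partial_r=(1,0)$ in $\mathbb H^{n+1}$. The linear quaternionic sphere assigns to $z$ the pair $(\eta_z,L_z|_{\eta_z})$, where $\eta_z\subset\mathbb R^{4n+3}$ is the hyperplane orthogonal to $L_z\partial_r$, cooriented by $L_z\partial_r$; it is $L_z$-invariant. A smooth map $\xi:S^2\to\mathcal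 C(M,\xi_0)$ is an almost-quaternionic sphere if 1. there is a family $(\mathfrak j_z)_{z\in S^2}$, continuous in $z$, of smooth almost complex structures $\mathfrak j_z$ on the hyperplane fields $\xi(z)=\ker\alpha_z$ that are compatible with $d\alpha_z|_{\xi(z)}$, i.e. $d\alpha_z(\mathfrak j_zu,\mathfrak j_zv)=d\alpha_z(u,v)$ and $d\alpha_z(u,\mathfrak j_zu)>0$ for $u\ne0$; and 2. there are an $n\ge 0$, a point $q\in M$ and a linear isomorphism $\tau:T_qM\to\mathbb R^{4n+3}$ such that for every $z\in S^2$ the map $\tau$ carries $(\xi(z)_q,\mathfrak j_{z,q})$, with its coorientation, to $(\eta_z,L_z|_{\eta_z})$. Then the class of every almost-quaternionic sphere $\xi$ in $\pi_2(\mathcal C(M,\xi_0),\xi(N))$, where $N\in S^2$ is the north pole, has infinite order. -/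

import Mathlib

open scoped Manifold ContDiff Topology unitInterval Quaternion UniformConvergence EuclideanSpace
open Bundle Metric

noncomputable section

namespace ContactSpheres

/-! ### Contact forms -/

/-- The model space `ℝ^{2m+1}`. -/
abbrev Model (m : ℕ) : Type := EuclideanSpace ℝ (Fin (2 * m + 1))

/-- The value of `a ∧ Ω^m` on `2m+1` vectors, for a linear form `a` and a bilinear form `Ω`
(up to a positive factor depending only on `m`): the full antisymmetrization of
`a ⊗ Ω ⊗ ⋯ ⊗ Ω`. -/
def wedgePow {V : Type*} (m : ℕ) (a : V → ℝ) (Ω : V → V → ℝ) (v : Fin (2 * m + 1) → V) : ℝ :=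
  ∑ s : Equiv.Perm (Fin (2 * m + 1)), ((Equiv.Perm.sign s : ℤ) : ℝ) *
    (a (v (s ⟨0, by omega⟩)) *
      ∏ i : Fin m, Ω (v (s ⟨2 * i + 1, by omega⟩)) (v (s ⟨2 * i + 2, by omega⟩)))

section Forms

variable {m : ℕ} {M : Type*} [TopologicalSpace M] [ChartedSpace (Model m) M]

/-- The coordinate expression of a 1-form in the preferred chart at `p`, that is, its pullback
under the inverse of that chart. It is meaningful on the target of the chart. -/
def localForm (α : ∀ x : M, TangentSpace (𝓡 (2 * m + 1)) x →L[ℝ] ℝ) (p : M) (y : Model m) :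
    Model m →L[ℝ] ℝ :=
  (α ((extChartAt (𝓡 (2 * m + 1)) p).symm y)).comp
    (mfderiv 𝓘(ℝ, Model m) (𝓡 (2 * m + 1)) (extChartAt (𝓡 (2 * m + 1)) p).symm y)

/-- The exterior derivative of a 1-form at `x`, computed in the preferred chart at `x`:
`dα(u, v) = D_u α (v) - D_v α (u)`. -/
def dForm (α : ∀ x : M, TangentSpace (𝓡 (2 * m + 1)) x →L[ℝ] ℝ) (x : M)
    (u v : TangentSpace (𝓡 (2 * m + 1)) x) : ℝ :=
  let φ := extChartAt (𝓡 (2 * m + 1)) x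
  let D := mfderiv (𝓡 (2 * m + 1)) 𝓘(ℝ, Model m) φ x
  fderiv ℝ (localForm α x) (φ x) (D u) (D v) - fderiv ℝ (localForm α x) (φ x) (D v) (D u)

end Forms

/-- A smooth contact form on a `(2m+1)`-manifold: `α ∧ (dα)^m` vanishes nowhere. -/
structure ContactForm (m : ℕ) (M : Type*) [TopologicalSpace M] [ChartedSpace (Model m) M]
    [IsManifold (𝓡 (2 * m + 1)) ∞ M] where
  toFun : ∀ x : M, TangentSpace (𝓡 (2 * m + 1)) x →L[ℝ] ℝ
  smooth : ContMDiff (𝓡 (2 * m + 1)) ((𝓡 (2 * m + 1)).prod 𝓘(ℝ, Model m →L[ℝ] ℝ)) ∞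
    (fun x : M => TotalSpace.mk' (Model m →L[ℝ] ℝ)
      (E := fun x : M => TangentSpace (𝓡 (2 * m + 1)) x →L[ℝ] ℝ) x (toFun x))
  contact : ∀ x, ∃ v : Fin (2 * m + 1) → TangentSpace (𝓡 (2 * m + 1)) x,
    wedgePow m (toFun x) (dForm toFun x) v ≠ 0

variable {m : ℕ} {M : Type*} [TopologicalSpace M] [ChartedSpace (Model m) M]
  [IsManifold (𝓡 (2 * m + 1)) ∞ M]

/-- The `C^∞` topology on contact forms: uniform convergence of the partial derivatives of all
orders of the coordinate expressions, on compact subsets of the chart domains. -/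
instance : TopologicalSpace (ContactForm m M) :=
  ⨅ (p : M) (k : ℕ), TopologicalSpace.induced
    (fun α : ContactForm m M => UniformOnFun.ofFun
      {K : Set (Model m) | IsCompact K ∧ K ⊆ (extChartAt (𝓡 (2 * m + 1)) p).target}
      (iteratedFDeriv ℝ k (localForm α.toFun p))) inferInstance

/-! ### Cooriented contact structures -/

/-- Two contact forms define the same cooriented hyperplane field when they are pointwise positive
multiples of each other (the factor is then automatically a smooth function). -/
instance ContactForm.setoid (m : ℕ) (M : Type*) [TopologicalSpace M] [ChartedSpace (Model m) M]
    [IsManifold (𝓡 (2 * m + 1)) ∞ M] : Setoid (ContactForm m M) where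
  r α β := ∀ x, ∃ c : ℝ, 0 < c ∧ β.toFun x = c • α.toFun x
  iseqv :=
    { refl := fun α x => ⟨1, one_pos, by simp⟩
      symm := fun {α β} h x => by
        obtain ⟨c, hc, e⟩ := h x
        exact ⟨c⁻¹, inv_pos.2 hc, by rw [e, smul_smul, inv_mul_cancel₀ hc.ne', one_smul]⟩
      trans := fun {α β γ} h h' x => by
        obtain ⟨c, hc, e⟩ := h x
        obtain ⟨c', hc', e'⟩ := h' x
        exact ⟨c' * c, mul_pos hc' hc, by rw [e', e, smul_smul]⟩ }

/-- Cooriented contact structures `ξ = ker α`, i.e. contact forms up to positive functions. -/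
def ContactStructure (m : ℕ) (M : Type*) [TopologicalSpace M] [ChartedSpace (Model m) M]
    [IsManifold (𝓡 (2 * m + 1)) ∞ M] : Type _ :=
  Quotient (ContactForm.setoid m M)

/-- The `C^∞` topology on cooriented contact structures. -/
instance : TopologicalSpace (ContactStructure m M) :=
  inferInstanceAs (TopologicalSpace (Quotient (ContactForm.setoid m M)))

/-- The cooriented contact structure `ker α`. -/
def ContactForm.ker (α : ContactForm m M) : ContactStructure m M :=
  Quotient.mk (ContactForm.setoid m M) α

/-- `ξ` is isotopic to `ξ₀`: there is a smooth isotopy `φ_t` of `M` with `φ_0 = id` such that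
`φ_1` carries `ξ₀` to `ξ`, coorientations included, i.e. `φ_1^* β` is a positive multiple of `α`
where `ξ₀ = ker α` and `ξ = ker β`. -/
def Isotopic (ξ₀ ξ : ContactStructure m M) : Prop :=
  ∃ φ : ℝ → Diffeomorph (𝓡 (2 * m + 1)) (𝓡 (2 * m + 1)) M M ∞,
    ContMDiff (𝓘(ℝ, ℝ).prod (𝓡 (2 * m + 1))) (𝓡 (2 * m + 1)) ∞
      (fun p : ℝ × M => φ p.1 p.2) ∧
    (∀ x, φ 0 x = x) ∧
    ∃ α β : ContactForm m M, α.ker = ξ₀ ∧ β.ker = ξ ∧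
      ∀ x, ∃ c : ℝ, 0 < c ∧
        (β.toFun (φ 1 x)).comp (mfderiv (𝓡 (2 * m + 1)) (𝓡 (2 * m + 1)) (φ 1) x) =
          c • α.toFun x

/-- The space `𝒞(M, ξ₀)` of contact structures isotopic to `ξ₀`, with the `C^∞` topology. -/
abbrev ContactSpace (ξ₀ : ContactStructure m M) : Type _ :=
  {ξ : ContactStructure m M // Isotopic ξ₀ ξ}

/-! ### Contact spheres and their homotopy classes -/

/-- The standard 2-sphere in `ℝ³`. -/
abbrev S2 : Type := sphere (0 : EuclideanSpace ℝ (Fin 3)) 1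

/-- A contact sphere: a smooth map `S² → 𝒞(M, ξ₀)`. Smoothness means that the structures are the
kernels of a family of forms that is smooth in both variables. -/
structure ContactSphere (ξ₀ : ContactStructure m M) where
  toMap : C(S2, ContactSpace ξ₀)
  smooth : ∃ A : S2 → ContactForm m M, (∀ z, (A z).ker = (toMap z).1) ∧
    ContMDiff ((𝓡 2).prod (𝓡 (2 * m + 1))) ((𝓡 (2 * m + 1)).prod 𝓘(ℝ, Model m →L[ℝ] ℝ)) ∞
      (fun p : S2 × M => TotalSpace.mk' (Model m →L[ℝ] ℝ)
        (E := fun x : M => TangentSpace (𝓡 (2 * m + 1)) x →L[ℝ] ℝ) p.2 ((A p.1).toFun p.2))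

/-- The point of `S²` with stereographic coordinates `(x/w, y/w)`, projecting from the north pole;
it is the north pole itself when `w = 0`. -/
def collapseVec (x y w : ℝ) : EuclideanSpace ℝ (Fin 3) :=
  !₂[2 * x * w / (x ^ 2 + y ^ 2 + w ^ 2), 2 * y * w / (x ^ 2 + y ^ 2 + w ^ 2),
    (x ^ 2 + y ^ 2 - w ^ 2) / (x ^ 2 + y ^ 2 + w ^ 2)]

theorem collapseVec_mem {x y w : ℝ} (h : x ^ 2 + y ^ 2 + w ^ 2 ≠ 0) :
    collapseVec x y w ∈ sphere (0 : EuclideanSpace ℝ (Fin 3)) 1 := by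
  rw [mem_sphere_zero_iff_norm, EuclideanSpace.norm_eq, Real.sqrt_eq_one, Fin.sum_univ_three]
  simp only [collapseVec, Real.norm_eq_abs, sq_abs]
  simp
  field_simp
  ring

theorem collapse_ne (x y : ℝ) : x ^ 2 + y ^ 2 + ((1 - x ^ 2) * (1 - y ^ 2)) ^ 2 ≠ 0 := by
  intro h
  have hx : x ^ 2 = 0 := by nlinarith [sq_nonneg x, sq_nonneg y, sq_nonneg ((1 - x^2) * (1 - y^2))]
  have hy : y ^ 2 = 0 := by nlinarith [sq_nonneg x, sq_nonneg y, sq_nonneg ((1 - x^2) * (1 - y^2))]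
  rw [hx, hy] at h
  norm_num at h

/-- The collapse `I² → I²/∂I² ≅ S²`: with `x = 2t₀ - 1`, `y = 2t₁ - 1`, it maps the open square
homeomorphically onto the sphere minus the north pole, through the stereographic coordinates
`(x, y) / ((1 - x²)(1 - y²))`, and the boundary of the square to the north pole. -/
def collapse : C(Fin 2 → I, S2) where
  toFun t := ⟨collapseVec (2 * t 0 - 1) (2 * t 1 - 1)
    ((1 - (2 * (t 0 : ℝ) - 1) ^ 2) * (1 - (2 * (t 1 : ℝ) - 1) ^ 2)),
    collapseVec_mem (collapse_ne _ _)⟩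
  continuous_toFun := by
    refine Continuous.subtype_mk ?_ _
    refine (PiLp.continuous_toLp 2 _).comp (continuous_pi fun i => ?_)
    have h := fun t : Fin 2 → I => collapse_ne (2 * (t 0 : ℝ) - 1) (2 * (t 1 : ℝ) - 1)
    fin_cases i <;> exact Continuous.div (by fun_prop) (by fun_prop) h

/-- The north pole `(0, 0, 1)`. -/
def northPole : S2 := ⟨collapseVec 1 0 0, collapseVec_mem (by norm_num)⟩

theorem collapse_boundary (t : Fin 2 → I) (ht : t ∈ Cube.boundary (Fin 2)) :
    collapse t = northPole := by
  have hw : (1 - (2 * (t 0 : ℝ) - 1) ^ 2) * (1 - (2 * (t 1 : ℝ) - 1) ^ 2) = 0 := by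
    obtain ⟨i, hi⟩ := ht
    fin_cases i <;> rcases hi with hi | hi <;> simp at hi <;> rw [hi] <;> norm_num
  have hne := collapse_ne (2 * (t 0 : ℝ) - 1) (2 * (t 1 : ℝ) - 1)
  apply Subtype.ext
  simp only [collapse, ContinuousMap.coe_mk, northPole, collapseVec]
  rw [hw] at hne ⊢
  simp only [ne_eq, OfNat.ofNat_ne_zero, not_false_eq_true, zero_pow, add_zero, sub_zero] at hne ⊢
  rw [div_self hne]
  norm_num

/-- The class in `π₂(X, f(N))` of a map `f : S² → X`, where `N` is the north pole. -/
def sphereClass {X : Type*} [TopologicalSpace X] (f : C(S2, X)) :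
    HomotopyGroup.Pi 2 X (f northPole) :=
  Quotient.mk (GenLoop.Homotopic.setoid (Fin 2) (f northPole))
    ⟨f.comp collapse, fun t ht => congrArg f (collapse_boundary t ht)⟩

/-! ### Almost complex structures and the linear quaternionic sphere -/

/-- `j` restricts to an almost complex structure on the contact hyperplanes `ker α`, compatible
with the symplectic form `dα` on them. Only the restriction of `j x` to `ker α x` matters; `j x`
is an arbitrary linear extension of it to the tangent space. -/
def Compatible (α : ContactForm m M)
    (j : ∀ x : M, TangentSpace (𝓡 (2 * m + 1)) x →L[ℝ] TangentSpace (𝓡 (2 * m + 1)) x) : Prop :=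
  ∀ x, ∀ u, α.toFun x u = 0 →
    α.toFun x (j x u) = 0 ∧ j x (j x u) = -u ∧
    (∀ v, α.toFun x v = 0 → dForm α.toFun x (j x u) (j x v) = dForm α.toFun x u v) ∧
    (u ≠ 0 → 0 < dForm α.toFun x u (j x u))

/-- `ℝ^{4n+3}` as the space `Im ℍ ⊕ ℍⁿ`, the orthogonal complement of the real unit `∂_r` of the
first factor in `ℍ^{n+1}`. -/
def ImH (n : ℕ) : Submodule ℝ (ℍ[ℝ] × (Fin n → ℍ[ℝ])) where
  carrier := {w | w.1.re = 0}
  add_mem' := by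
    intro a b ha hb
    simp only [Set.mem_ofPred_eq] at ha hb ⊢
    simp [ha, hb]
  zero_mem' := by simp
  smul_mem' := by
    intro c a ha
    simp only [Set.mem_ofPred_eq] at ha ⊢
    simp [ha]

/-- The unit imaginary quaternion `e₀ i + e₁ j + e₂ k` attached to a point of `S²`. -/
def unitIm (z : S2) : ℍ[ℝ] := ⟨0, z.1 0, z.1 1, z.1 2⟩

/-- The linear form `w ↦ ⟨𝐣 ∂_r, w⟩` on `ℝ^{4n+3}`, where `𝐣 = e₀ I + e₁ J + e₂ K` and `I`, `J`, `K`
are the left multiplications by `i`, `j`, `k`; its kernel is the space of `𝐣`-complex tangencies. -/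
def linearForm (n : ℕ) (z : S2) (w : ImH n) : ℝ := inner ℝ (unitIm z) w.1.1

/-- A contact sphere is almost-quaternionic: there are compatible almost complex structures
`j_z` on the structures `ξ(z)` (each of them smooth on `M`, and depending continuously on `z`), a
point `q` and a framing `τ : T_qM ≅ ℝ^{4n+3}` that carries `(ξ(z)_q, j_{z,q})`, with its
coorientation, to the member of the linear quaternionic sphere at `z`, namely the kernel of
`linearForm n z` with the left multiplication by `e₀ i + e₁ j + e₂ k`. -/
def ContactSphere.AlmostQuaternionic {ξ₀ : ContactStructure m M} (S : ContactSphere ξ₀) : Prop :=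
  ∃ j : S2 → ∀ x : M, TangentSpace (𝓡 (2 * m + 1)) x →L[ℝ] TangentSpace (𝓡 (2 * m + 1)) x,
    Continuous (fun p : S2 × M => TotalSpace.mk' (Model m →L[ℝ] Model m)
      (E := fun x : M => TangentSpace (𝓡 (2 * m + 1)) x →L[ℝ] TangentSpace (𝓡 (2 * m + 1)) x)
      p.2 (j p.1 p.2)) ∧
    (∀ z, ContMDiff (𝓡 (2 * m + 1)) ((𝓡 (2 * m + 1)).prod 𝓘(ℝ, Model m →L[ℝ] Model m)) ∞
      (fun x : M => TotalSpace.mk' (Model m →L[ℝ] Model m)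
        (E := fun x : M => TangentSpace (𝓡 (2 * m + 1)) x →L[ℝ] TangentSpace (𝓡 (2 * m + 1)) x)
        x (j z x))) ∧
    (∀ z, ∀ α : ContactForm m M, α.ker = (S.toMap z).1 → Compatible α (j z)) ∧
    ∃ (n : ℕ) (q : M) (τ : TangentSpace (𝓡 (2 * m + 1)) q ≃ₗ[ℝ] ImH n),
      ∀ z, ∀ α : ContactForm m M, α.ker = (S.toMap z).1 →
        (∃ c : ℝ, 0 < c ∧ ∀ u, α.toFun q u = c * linearForm n z (τ u)) ∧
        ∀ u, α.toFun q u = 0 → (τ (j z q u)).1 = unitIm z • (τ u).1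

end ContactSpheres

end

noncomputable section

namespace ContactSpheres

section Involutions

/-! ### Continuous logarithms -/

/-! The class is detected at the single point `q`. A cooriented contact structure determines at `q`
a hyperplane `ker a` of `V = T_qM` together with the conformal class of a symplectic form `Ω` on it.
Adding a line `ℝe`, the form `Ω + e^* ∧ a` on `Q = V ⊕ ℝe`, suitably normalized, is nondegenerate
and depends only on these data. If `B` is its matrix in an orthonormal basis, then `iB` is Hermitian
and invertible, and its sign (the unitary part of the polar decomposition) is an involution. This
gives a continuous map from the space of contact structures to complex matrices of square one
(`structureInvolution`, `continuous_structureInvolution`).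

Over a square modulo its boundary such a family has a `+1`-eigenbundle, whose first Chern number is
computed by clutching: trivialize the family so that the trivialization is the identity on three
sides, and follow a logarithm of its determinant on the eigenspace along the fourth side. This is
`HasWinding`. It is independent of the trivialization (`HasWinding.unique`), invariant under
homotopy (`HasWinding.homotopy`) and additive under concatenation (`HasWinding.concat`), so a class
of nonzero winding has infinite order (`HasWinding.not_isOfFinOrder`).

For an almost-quaternionic sphere, the framing identifies `Q` with `ℍ^{n+1}` and `e` with `∂_r`. The
stabilized form at `z` is then compatible with left multiplication `L_z`, so its sign is `-i L_z`
(`matrixSign_framing`). The `+1`-eigenbundle of `-i L_z` is a sum of copies of one nontrivial line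
bundle over `S²`, all of the same degree, so nothing cancels: the winding is a nonzero constant
times the rank (`hasWinding_collapse`). -/

theorem exists_log_of_ne_zero (f : C(I × I, ℂ)) (hf : ∀ x, f x ≠ 0) :
    ∃ l : C(I × I, ℂ), ∀ x, Complex.exp (l x) = f x := by
  let r : C(ℝ × ℝ, I × I) :=
    ⟨fun x => (Set.projIcc 0 1 zero_le_one x.1, Set.projIcc 0 1 zero_le_one x.2), by
      have := continuous_projIcc (a := (0 : ℝ)) (b := 1) (h := zero_le_one)
      fun_prop⟩
  let F : C(ℝ × ℝ, {z : ℂ // z ≠ 0}) :=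
    ⟨fun x => ⟨f (r x), hf _⟩, by fun_prop⟩
  obtain ⟨L, ⟨-, hL⟩, -⟩ := Complex.isCoveringMap_exp.existsUnique_continuousMap_lifts F 0
    (Complex.log (f (r 0))) (Subtype.ext (Complex.exp_log (hf _)))
  refine ⟨⟨fun x => L (x.1, x.2), by fun_prop⟩, fun x => ?_⟩
  have h := congrArg Subtype.val (congrFun hL ((x.1 : ℝ), (x.2 : ℝ)))
  simpa [F, r] using h

/-- Both `f` and the constant `f y` lift the constant map `1` through the covering `exp`, and they
agree at `y`. This is how logarithms are shown to be constant along sides where a trivialization is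
the identity. -/
theorem eq_of_exp_eq_one {X : Type*} [TopologicalSpace X] [PreconnectedSpace X] {f : X → ℂ}
    (hf : Continuous f) (h : ∀ x, Complex.exp (f x) = 1) (x y : X) : f x = f y := by
  have := Complex.isCoveringMap_exp.eq_of_comp_eq (g₁ := f) (g₂ := fun _ => f y) hf
    continuous_const (by ext z; simp [h]) y rfl
  exact congrFun this x

/-! ### Families of involutions -/

variable {ι : Type*} [Fintype ι] [DecidableEq ι]

theorem continuous_matrix_inv {X : Type*} [TopologicalSpace X] {A : X → Matrix ι ι ℂ}
    (hA : Continuous A) (h : ∀ x, IsUnit (A x)) : Continuous fun x => (A x)⁻¹ := by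
  have : (fun x => (A x)⁻¹) = fun x => ((A x).det)⁻¹ • (A x).adjugate := by
    ext1 x
    rw [Matrix.inv_def, Ring.inverse_eq_inv']
  rw [this]
  exact (hA.matrix_det.inv₀ fun x => ((Matrix.isUnit_iff_isUnit_det _).1 (h x)).ne_zero).smul
    hA.matrix_adjugate

/-- An intertwiner between two involutions. It is invertible when they are close to each other. -/
def transfer (A B : Matrix ι ι ℂ) : Matrix ι ι ℂ := (1 / 2 : ℂ) • (1 + A * B)

theorem transfer_self {A : Matrix ι ι ℂ} (hA : A * A = 1) : transfer A A = 1 := by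
  rw [transfer, hA, ← two_smul ℂ (1 : Matrix ι ι ℂ), smul_smul]
  norm_num

/-- Both sides equal `(A + B) / 2`. -/
theorem mul_transfer {A B : Matrix ι ι ℂ} (hA : A * A = 1) (hB : B * B = 1) :
    A * transfer A B = transfer A B * B := by
  simp only [transfer, Matrix.mul_smul, Matrix.smul_mul, mul_add, add_mul, mul_one, one_mul,
    ← mul_assoc, hA, mul_assoc A B B, hB]
  rw [add_comm]

/-- A family of involutions over `X × I` is conjugate to its restriction to `X × {0}`, by a
conjugation that is trivial wherever the family is constant in the second variable. -/
theorem exists_trivialization {X : Type*} [MetricSpace X] [CompactSpace X]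
    {G : X × I → Matrix ι ι ℂ} (hG : Continuous G) (hinv : ∀ p, G p * G p = 1) :
    ∃ g : X × I → Matrix ι ι ℂ, Continuous g ∧ (∀ p, IsUnit (g p)) ∧
      (∀ p, G p * g p = g p * G (p.1, 0)) ∧ (∀ x, g (x, 0) = 1) ∧
      ∀ x, (∀ t, G (x, t) = G (x, 0)) → ∀ t, g (x, t) = 1 := by
  let D : X × I × I → ℂ := fun p => (transfer (G (p.1, p.2.1)) (G (p.1, p.2.2))).det
  have hT : Continuous fun p : X × I × I => transfer (G (p.1, p.2.1)) (G (p.1, p.2.2)) := by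
    unfold transfer
    fun_prop
  have hD : Continuous D := hT.matrix_det
  obtain ⟨δ, hδ, hunif⟩ := Metric.uniformContinuous_iff.1
    (CompactSpace.uniformContinuous_of_continuous hD) 1 one_pos
  -- The determinant `D` is `1` when the two times coincide and moves by less than `1` within `δ`,
  -- so it does not vanish.
  have hclose : ∀ x : X, ∀ s t : I, dist s t < δ →
      IsUnit (transfer (G (x, s)) (G (x, t))) := by
    intro x s t hst
    rw [Matrix.isUnit_iff_isUnit_det, isUnit_iff_ne_zero]
    intro h0
    have h := @hunif (x, s, t) (x, t, t) (by
      simpa [Prod.dist_eq, hδ] using hst)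
    have h1 : D (x, t, t) = 1 := by simp [D, transfer_self (hinv _)]
    have h2 : D (x, s, t) = 0 := h0
    rw [h1, h2] at h
    simp at h
  obtain ⟨N, hN⟩ := exists_nat_gt (1 / δ)
  have hNpos : (0 : ℝ) < N := lt_trans (by positivity) hN
  let node : ℕ → I := fun k => Set.projIcc 0 1 zero_le_one ((k : ℝ) / N)
  have hnode : ∀ k, dist (node (k + 1)) (node k) < δ := by
    intro k
    have h1 : dist (node (k + 1)) (node k) ≤ |((k + 1 : ℕ) : ℝ) / N - (k : ℝ) / N| :=
      Set.abs_projIcc_sub_projIcc zero_le_one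
    refine h1.trans_lt ?_
    have : ((k + 1 : ℕ) : ℝ) / N - (k : ℝ) / N = 1 / N := by push_cast; ring
    rw [this, abs_of_pos (by positivity)]
    rwa [one_div_lt hNpos hδ]
  -- Discrete parallel transport along the nodes. Truncating the nodes at the time `p.2` makes every
  -- factor beyond it `transfer A A = 1`, which keeps the product continuous in time.
  let g : ℕ → X × I → Matrix ι ι ℂ := fun k => Nat.rec (fun _ => 1)
    (fun k gk p => transfer (G (p.1, p.2 ⊓ node (k + 1))) (G (p.1, p.2 ⊓ node k)) * gk p) k
  have hgs : ∀ k p, g (k + 1) p =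
    transfer (G (p.1, p.2 ⊓ node (k + 1))) (G (p.1, p.2 ⊓ node k)) * g k p := fun _ _ => rfl
  have hg0 : ∀ p, g 0 p = 1 := fun _ => rfl
  have hnode0 : node 0 = 0 := by
    simp only [node, Nat.cast_zero, zero_div]
    exact Set.projIcc_left zero_le_one
  have hnodeN : node N = 1 := by
    simp only [node, div_self hNpos.ne']
    exact Set.projIcc_right zero_le_one
  refine ⟨g N, ?_, ?_, ?_, ?_, ?_⟩
  · suffices ∀ k, Continuous (g k) from this N
    intro k
    induction k with
    | zero => exact continuous_const
    | succ k ih =>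
      have : Continuous fun p : X × I => (p.1, p.2 ⊓ node (k + 1), p.2 ⊓ node k) := by fun_prop
      exact (hT.comp this).mul ih
  · suffices ∀ k p, IsUnit (g k p) from this N
    intro k p
    induction k with
    | zero => exact isUnit_one
    | succ k ih =>
      refine IsUnit.mul (hclose _ _ _ (lt_of_le_of_lt ?_ (hnode k))) ih
      simp only [Subtype.dist_eq, Real.dist_eq]
      have h := abs_min_sub_min_le_max (p.2 : ℝ) (node (k + 1)) (p.2 : ℝ) (node k)
      rw [sub_self, abs_zero, max_eq_right (abs_nonneg _)] at h
      exact h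
  · suffices ∀ k p, G (p.1, p.2 ⊓ node k) * g k p = g k p * G (p.1, 0) by
      intro p
      have h := this N p
      rwa [hnodeN, inf_of_le_left unitInterval.le_one'] at h
    intro k p
    induction k with
    | zero => rw [hnode0, hg0, inf_of_le_right unitInterval.nonneg', mul_one, one_mul]
    | succ k ih =>
      rw [hgs, ← mul_assoc, mul_transfer (hinv _) (hinv _), mul_assoc, ih, mul_assoc]
  · suffices ∀ k x, g k (x, 0) = 1 from this N
    intro k x
    induction k with
    | zero => rfl
    | succ k ih =>
      rw [hgs, ih, mul_one]
      simp only [inf_of_le_left unitInterval.nonneg']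
      exact transfer_self (hinv _)
  · suffices ∀ k x, (∀ t, G (x, t) = G (x, 0)) → ∀ t, g k (x, t) = 1 from this N
    intro k x hx t
    induction k with
    | zero => rfl
    | succ k ih =>
      rw [hgs, ih, mul_one, hx, hx (_ ⊓ node k)]
      exact transfer_self (hinv _)

/-- The determinant of `g` on the `+1`-eigenspace of the involution `G`, for `g` commuting
with `G`. -/
def eigenDet (G g : Matrix ι ι ℂ) : ℂ := ((1 / 2 : ℂ) • ((1 + G) * g + (1 - G))).det

theorem eigenDet_one (G : Matrix ι ι ℂ) : eigenDet G 1 = 1 := by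
  have : (1 / 2 : ℂ) • ((1 + G) * 1 + (1 - G)) = 1 := by
    rw [mul_one, add_add_sub_cancel, ← two_smul ℂ (1 : Matrix ι ι ℂ), smul_smul]
    norm_num
  rw [eigenDet, this, Matrix.det_one]

/-- With the projection `P = (1 + G) / 2`, which commutes with `g`, one has `(P g + 1 - P) (P h + 1
- P) = P g h + 1 - P`; the cross terms vanish because `P (1 - P) = 0`. Only `g` has to commute with
`G`. -/
theorem eigenDet_mul {G g h : Matrix ι ι ℂ} (hG : G * G = 1) (hg : G * g = g * G) :
    eigenDet G (g * h) = eigenDet G g * eigenDet G h := by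
  rw [eigenDet, eigenDet, eigenDet, ← Matrix.det_mul]
  congr 1
  rw [Matrix.smul_mul, Matrix.mul_smul, smul_smul]
  have e1 : (1 + G) * g * ((1 + G) * h) = (2 : ℂ) • ((1 + G) * (g * h)) := by
    have : (1 + G) * g = g * (1 + G) := by rw [add_mul, mul_add, hg, one_mul, mul_one]
    rw [mul_assoc, ← mul_assoc g, ← this, ← mul_assoc, ← mul_assoc, ← mul_assoc, two_smul]
    have h2 : (1 + G) * (1 + G) = (1 + G) + (1 + G) := by
      simp only [mul_add, add_mul, mul_one, one_mul, hG]; abel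
    rw [h2, add_mul, add_mul]
  have e2 : (1 + G) * g * (1 - G) = 0 := by
    have : g * (1 - G) = (1 - G) * g := by rw [sub_mul, mul_sub, hg, one_mul, mul_one]
    have h0 : (1 + G) * (1 - G) = 0 := by
      simp only [mul_sub, add_mul, mul_one, one_mul, hG]; abel
    rw [mul_assoc, this, ← mul_assoc, h0, zero_mul]
  have e3 : (1 - G) * ((1 + G) * h) = 0 := by
    have h0 : (1 - G) * (1 + G) = 0 := by
      simp only [mul_add, sub_mul, mul_one, one_mul, hG]; abel
    rw [← mul_assoc, h0, zero_mul]
  have e4 : (1 - G) * (1 - G) = (2 : ℂ) • (1 - G) := by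
    simp only [mul_sub, sub_mul, mul_one, one_mul, hG, two_smul]; abel
  rw [mul_add ((1 + G) * g + (1 - G)), add_mul _ _ ((1 + G) * h), add_mul _ _ (1 - G), e1, e2, e3, e4, add_zero, zero_add, ← smul_add, smul_smul]
  norm_num

theorem eigenDet_ne_zero {G g : Matrix ι ι ℂ} (hG : G * G = 1) (hg : G * g = g * G)
    (hu : IsUnit g) : eigenDet G g ≠ 0 := by
  intro h0
  have h := eigenDet_mul (h := g⁻¹) hG hg
  rw [Matrix.mul_nonsing_inv _ ((Matrix.isUnit_iff_isUnit_det _).1 hu), eigenDet_one, h0,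
    zero_mul] at h
  exact one_ne_zero h

theorem continuous_eigenDet (G : Matrix ι ι ℂ) : Continuous (eigenDet G) := by
  unfold eigenDet
  exact Continuous.matrix_det (by fun_prop)

/-! ### The winding of a square of involutions -/

/-- `g` trivializes the family `G` of involutions over the square, and is trivial on three of its
sides. -/
structure IsTrivialization (G g : I × I → Matrix ι ι ℂ) : Prop where
  continuous : Continuous g
  isUnit : ∀ p, IsUnit (g p)
  intertwines : ∀ p, G p * g p = g p * G 0
  bottom : ∀ s, g (s, 0) = 1
  left : ∀ t, g (0, t) = 1
  right : ∀ t, g (1, t) = 1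

/-- `d` is `2πi` times the first Chern number of the `+1`-eigenbundle of the family `G` of
involutions over the square modulo its boundary. -/
def HasWinding (G : I × I → Matrix ι ι ℂ) (d : ℂ) : Prop :=
  ∃ g, IsTrivialization G g ∧ ∃ l : C(I, ℂ),
    (∀ s, Complex.exp (l s) = eigenDet (G 0) (g (s, 1))) ∧ l 1 - l 0 = d

/-- Two trivializations differ by `k = g'⁻¹ g`, which commutes with `G 0`. Its determinant on the
eigenspace has a logarithm `L` over the whole square, constant along the three sides where `k = 1`;
hence `L` takes equal values at the two top corners and contributes nothing to the difference of the
windings. -/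
theorem HasWinding.unique {G : I × I → Matrix ι ι ℂ} (hG : G 0 * G 0 = 1)
    (htop : ∀ s, G (s, 1) = G 0) {d d' : ℂ} (h : HasWinding G d) (h' : HasWinding G d') :
    d = d' := by
  obtain ⟨g, hg, l, hl, rfl⟩ := h
  obtain ⟨g', hg', l', hl', rfl⟩ := h'
  have hdet : ∀ p, IsUnit (g' p).det := fun p => (Matrix.isUnit_iff_isUnit_det _).1 (hg'.isUnit p)
  let k : I × I → Matrix ι ι ℂ := fun p => (g' p)⁻¹ * g p
  have hk : Continuous k := (continuous_matrix_inv hg'.continuous hg'.isUnit).mul hg.continuous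
  have hkc : ∀ p, G 0 * k p = k p * G 0 := by
    intro p
    have h1 : (g' p)⁻¹ * G p = G 0 * (g' p)⁻¹ := by
      calc (g' p)⁻¹ * G p = (g' p)⁻¹ * (G p * g' p) * (g' p)⁻¹ := by
            rw [mul_assoc, mul_assoc, Matrix.mul_nonsing_inv _ (hdet p), mul_one]
        _ = G 0 * (g' p)⁻¹ := by
            rw [hg'.intertwines, ← mul_assoc, Matrix.nonsing_inv_mul _ (hdet p), one_mul]
    rw [← mul_assoc, ← h1, mul_assoc, hg.intertwines, mul_assoc]
  have hku : ∀ p, IsUnit (k p) := fun p =>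
    IsUnit.mul ((Matrix.isUnit_nonsing_inv_iff).2 (hg'.isUnit p)) (hg.isUnit p)
  obtain ⟨L, hL⟩ := exists_log_of_ne_zero ⟨fun p => eigenDet (G 0) (k p),
    (continuous_eigenDet _).comp hk⟩ fun p => eigenDet_ne_zero hG (hkc p) (hku p)
  simp only [ContinuousMap.coe_mk] at hL
  have hL1 : ∀ p, g p = 1 → g' p = 1 → Complex.exp (L p) = 1 := by
    intro p h1 h2
    rw [hL]
    simp [k, h1, h2, eigenDet_one]
  have e1 : L (0, 1) = L (0, 0) := eq_of_exp_eq_one (f := fun t : I => L (0, t)) (by fun_prop)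
    (fun t => hL1 _ (hg.left t) (hg'.left t)) 1 0
  have e2 : L (1, 1) = L (1, 0) := eq_of_exp_eq_one (f := fun t : I => L (1, t)) (by fun_prop)
    (fun t => hL1 _ (hg.right t) (hg'.right t)) 1 0
  have e3 : L (0, 0) = L (1, 0) := eq_of_exp_eq_one (f := fun t : I => L (t, 0)) (by fun_prop)
    (fun t => hL1 _ (hg.bottom t) (hg'.bottom t)) 0 1
  have e4 := eq_of_exp_eq_one (f := fun s : I => l s - l' s - L (s, 1)) (by fun_prop)
    (fun s => by
      have hgk : g (s, 1) = g' (s, 1) * k (s, 1) := by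
        simp only [k]
        rw [← mul_assoc, Matrix.mul_nonsing_inv _ (hdet _), one_mul]
      have hc : G 0 * g' (s, 1) = g' (s, 1) * G 0 := by
        rw [← hg'.intertwines, htop]
      have hne : eigenDet (G 0) (g' (s, 1)) ≠ 0 := eigenDet_ne_zero hG hc (hg'.isUnit _)
      have hne' : eigenDet (G 0) (k (s, 1)) ≠ 0 := eigenDet_ne_zero hG (hkc _) (hku _)
      rw [Complex.exp_sub, Complex.exp_sub, hl, hl', hL, hgk, eigenDet_mul hG hc]
      field_simp) 0 1
  linear_combination -e4 - e1 + e2 - e3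

theorem HasWinding.const {A : Matrix ι ι ℂ} : HasWinding (fun _ => A) 0 := by
  refine ⟨fun _ => 1, ⟨continuous_const, fun _ => isUnit_one, fun _ => by simp, fun _ => rfl,
    fun _ => rfl, fun _ => rfl⟩, 0, fun s => ?_, by simp⟩
  simp [eigenDet_one]

/-- The winding is invariant under homotopies of squares relative to the boundary. -/
theorem HasWinding.homotopy {A : Matrix ι ι ℂ} {G : I × I × I → Matrix ι ι ℂ} (hG : Continuous G)
    (hinv : ∀ p, G p * G p = 1) (hbot : ∀ r s, G (r, s, 0) = A) (htop : ∀ r s, G (r, s, 1) = A)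
    (hleft : ∀ r t, G (r, 0, t) = A) (hright : ∀ r t, G (r, 1, t) = A) {d d' : ℂ}
    (h : HasWinding (fun p => G (0, p)) d) (h' : HasWinding (fun p => G (1, p)) d') : d = d' := by
  have hA : A * A = 1 := by rw [← hbot 0 0]; exact hinv _
  -- One trivialization serves all squares at once: the base consists of the homotopy parameter and
  -- the first coordinate, and transport runs along the second coordinate. Since the family is
  -- constant over the left and right sides, the trivialization is the identity there.
  obtain ⟨g, hgc, hgu, hgi, hg0, hg1⟩ := exists_trivialization
    (G := fun p : (I × I) × I => G (p.1.1, p.1.2, p.2)) (by fun_prop) fun p => hinv _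
  simp only [hbot] at hgi hg1
  obtain ⟨L, hL⟩ := exists_log_of_ne_zero ⟨fun p => eigenDet A (g (p, 1)),
    (continuous_eigenDet _).comp (by fun_prop)⟩ fun p => eigenDet_ne_zero hA (by
      have := hgi (p, 1)
      rwa [htop] at this) (hgu _)
  simp only [ContinuousMap.coe_mk] at hL
  have hL0 : ∀ r, Complex.exp (L (r, 0)) = 1 := fun r => by
    rw [hL, hg1 _ (by simp [hleft]), eigenDet_one]
  have hL1 : ∀ r, Complex.exp (L (r, 1)) = 1 := fun r => by
    rw [hL, hg1 _ (by simp [hright]), eigenDet_one]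
  have hw : ∀ r, HasWinding (fun p => G (r, p)) (L (r, 1) - L (r, 0)) := fun r =>
    ⟨fun p => g ((r, p.1), p.2), ⟨by fun_prop, fun p => hgu _, fun p => by
        have := hgi ((r, p.1), p.2)
        simpa [show G (r, 0) = A from hbot r 0] using this, fun s => hg0 _,
      fun t => hg1 _ (by simp [hleft]) t, fun t => hg1 _ (by simp [hright]) t⟩,
      ⟨fun s => L (r, s), by fun_prop⟩, fun s => by
        simp only [ContinuousMap.coe_mk, hL]
        rw [show G (r, 0) = A from hbot r 0], rfl⟩
  have hu : ∀ r {d d' : ℂ}, HasWinding (fun p => G (r, p)) d → HasWinding (fun p => G (r, p)) d' →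
      d = d' := fun r _ _ h h' => HasWinding.unique (hinv _)
        (fun s => (htop r s).trans (hbot r 0).symm) h h'
  rw [hu 0 h (hw 0), hu 1 h' (hw 1)]
  have e0 := eq_of_exp_eq_one (f := fun r : I => L (r, 0)) (by fun_prop) hL0 0 1
  have e1 := eq_of_exp_eq_one (f := fun r : I => L (r, 1)) (by fun_prop) hL1 0 1
  rw [e0, e1]

/-- The concatenation of two functions on `I` (meaningful if they agree at the common end). -/
def concat {Y : Type*} (f g : I → Y) (s : I) : Y :=
  if (s : ℝ) ≤ 1 / 2 then f (Set.projIcc 0 1 zero_le_one (2 * s))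
  else g (Set.projIcc 0 1 zero_le_one (2 * s - 1))

theorem concat_zero {Y : Type*} (f g : I → Y) : concat f g 0 = f 0 := by
  simp [concat]

theorem concat_one {Y : Type*} (f g : I → Y) : concat f g 1 = g 1 := by
  have : ¬ (1 : ℝ) ≤ 2⁻¹ := by norm_num
  have h2 : (2 : ℝ) - 1 = 1 := by norm_num
  simp [concat, this, h2]

theorem continuous_concat {X Y : Type*} [TopologicalSpace X] [TopologicalSpace Y]
    {f g : I × X → Y} (hf : Continuous f) (hg : Continuous g) (h : ∀ x, f (1, x) = g (0, x)) :
    Continuous fun p : I × X => concat (fun s => f (s, p.2)) (fun s => g (s, p.2)) p.1 := by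
  have hp := continuous_projIcc (a := (0 : ℝ)) (b := 1) (h := zero_le_one)
  refine Continuous.if_le (by fun_prop) (by fun_prop) (by fun_prop) (by fun_prop) ?_
  intro p hp
  simp only [hp]
  norm_num
  exact h _

theorem HasWinding.concat {A : Matrix ι ι ℂ} {G G' : I × I → Matrix ι ι ℂ} 
    (hG0 : G 0 = A) (hG0' : G' 0 = A) {d d' : ℂ} (h : HasWinding G d) (h' : HasWinding G' d') :
    HasWinding (fun p => ContactSpheres.concat (fun s => G (s, p.2)) (fun s => G' (s, p.2)) p.1)
      (d + d') := by
  obtain ⟨g, hg, l, hl, rfl⟩ := h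
  obtain ⟨g', hg', l', hl', rfl⟩ := h'
  have h0 : ContactSpheres.concat (fun s => G (s, (0 : I × I).2)) (fun s => G' (s, (0 : I × I).2))
      (0 : I × I).1 = A := by
    rw [Prod.fst_zero, concat_zero]; exact hG0
  refine ⟨fun p => ContactSpheres.concat (fun s => g (s, p.2)) (fun s => g' (s, p.2)) p.1,
    ⟨continuous_concat hg.continuous hg'.continuous fun t => by rw [hg.right, hg'.left], ?_, ?_,
      ?_, ?_, ?_⟩,
    -- The second logarithm is shifted to start where the first one ends. The shift is invisible to
    -- `exp`, since both trivializations are the identity at the junction.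
    ⟨ContactSpheres.concat (fun s => l s) (fun s => l' s - l' 0 + l 1), ?_⟩, ?_, ?_⟩
  · intro p
    unfold ContactSpheres.concat
    split_ifs
    exacts [hg.isUnit _, hg'.isUnit _]
  · intro p
    rw [h0]
    unfold ContactSpheres.concat
    split_ifs
    · rw [hg.intertwines, hG0]
    · rw [hg'.intertwines, hG0']
  · intro s
    unfold ContactSpheres.concat
    split_ifs
    exacts [hg.bottom _, hg'.bottom _]
  · intro t
    rw [concat_zero, hg.left]
  · intro t
    rw [concat_one, hg'.right]
  · have := continuous_concat (X := Unit) (f := fun p => l p.1) (g := fun p => l' p.1 - l' 0 + l 1)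
      (by fun_prop) (by fun_prop) (by simp)
    exact this.comp (continuous_id.prodMk (continuous_const (y := ())))
  · intro s
    have e0 : Complex.exp (l' 0) = 1 := by rw [hl', hg'.left, eigenDet_one]
    have e1 : Complex.exp (l 1) = 1 := by rw [hl, hg.right, eigenDet_one]
    simp only [ContinuousMap.coe_mk]
    rw [h0]
    unfold ContactSpheres.concat
    split_ifs
    · rw [hl, hG0]
    · rw [Complex.exp_add, Complex.exp_sub, e0, e1, hl', hG0', div_one, mul_one]
  · simp only [ContinuousMap.coe_mk, concat_zero, concat_one]
    ring

end Involutions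

section HomotopyGroup

variable {ι : Type*} [Fintype ι] [DecidableEq ι]

/-! ### Winding and the second homotopy group -/

theorem update_vec_two {Y : Type*} (a b c : Y) : Function.update ![a, b] 0 c = ![c, b] := by
  ext i
  fin_cases i <;> simp

theorem HasWinding.transAt {X : Type*} [TopologicalSpace X] {x : X} {Φ : X → Matrix ι ι ℂ}
    {p q : GenLoop (Fin 2) X x} {d d' : ℂ}
    (h : HasWinding (fun s : I × I => Φ (p ![s.1, s.2])) d)
    (h' : HasWinding (fun s : I × I => Φ (q ![s.1, s.2])) d') :
    HasWinding (fun s : I × I => Φ (GenLoop.transAt 0 p q ![s.1, s.2])) (d + d') := by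
  have hb : ∀ r : GenLoop (Fin 2) X x, Φ (r ![(0 : I × I).1, (0 : I × I).2]) = Φ x := fun r => by
    rw [GenLoop.boundary r _ ⟨0, Or.inl rfl⟩]
  convert h.concat (hb p) (hb q) h' using 2 with s
  simp only [GenLoop.transAt, GenLoop.coe_copy, ContactSpheres.concat, Matrix.cons_val_zero, update_vec_two]
  split_ifs <;> rfl

theorem HasWinding.eq_of_homotopic {X : Type*} [TopologicalSpace X] {x : X} {Φ : X → Matrix ι ι ℂ}
    (hΦ : Continuous Φ) (hinv : ∀ y, Φ y * Φ y = 1) {p q : GenLoop (Fin 2) X x}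
    (hpq : GenLoop.Homotopic p q) {d d' : ℂ}
    (h : HasWinding (fun s : I × I => Φ (p ![s.1, s.2])) d)
    (h' : HasWinding (fun s : I × I => Φ (q ![s.1, s.2])) d') : d = d' := by
  obtain ⟨F⟩ := hpq
  have hF : ∀ r y, y ∈ Cube.boundary (Fin 2) → F (r, y) = x := fun r y hy => by
    rw [F.eq_fst r hy]
    exact p.2 y hy
  refine HasWinding.homotopy (A := Φ x) (G := fun s : I × I × I => Φ (F (s.1, ![s.2.1, s.2.2])))
    ?_ (fun _ => hinv _) (fun r s => ?_) (fun r s => ?_) (fun r s => ?_) (fun r s => ?_)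
    (d := d) (d' := d') ?_ ?_
  · refine hΦ.comp (F.continuous.comp (continuous_fst.prodMk (continuous_pi fun i => ?_)))
    fin_cases i
    · exact continuous_fst.comp continuous_snd
    · exact continuous_snd.comp continuous_snd
  · rw [hF _ _ ⟨1, Or.inl rfl⟩]
  · rw [hF _ _ ⟨1, Or.inr rfl⟩]
  · rw [hF _ _ ⟨0, Or.inl rfl⟩]
  · rw [hF _ _ ⟨0, Or.inr rfl⟩]
  · simpa using h
  · simpa using h'

/-- A loop of nonzero winding has infinite order in the second homotopy group. -/
theorem HasWinding.not_isOfFinOrder {X : Type*} [TopologicalSpace X] {x : X}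
    {Φ : X → Matrix ι ι ℂ} (hΦ : Continuous Φ) (hinv : ∀ y, Φ y * Φ y = 1)
    {p : GenLoop (Fin 2) X x} {d : ℂ} (hd : d ≠ 0)
    (h : HasWinding (fun s : I × I => Φ (p ![s.1, s.2])) d) {c : HomotopyGroup.Pi 2 X x}
    (hc : c = Quotient.mk (GenLoop.Homotopic.setoid (Fin 2) x) p) : ¬ IsOfFinOrder c := by
  have key : ∀ k : ℕ, ∃ q : GenLoop (Fin 2) X x,
      c ^ k = Quotient.mk (GenLoop.Homotopic.setoid (Fin 2) x) q ∧
      HasWinding (fun s : I × I => Φ (q ![s.1, s.2])) (k * d) := by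
    intro k
    induction k with
    | zero =>
      refine ⟨GenLoop.const, by rw [pow_zero]; rfl, ?_⟩
      simpa using HasWinding.const (A := Φ x)
    | succ k ih =>
      obtain ⟨q, hq, hw⟩ := ih
      -- `HomotopyGroup.mul_spec` reverses the order: `c ^ k * c`, the class of `q` times that of
      -- `p`, is represented by `p` followed by `q`.
      refine ⟨GenLoop.transAt 0 p q, ?_, ?_⟩
      · rw [pow_succ, hq, hc]
        exact HomotopyGroup.mul_spec
      · have := h.transAt hw
        rwa [show d + k * d = ((k + 1 : ℕ) : ℂ) * d by push_cast; ring] at this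
  intro hfin
  obtain ⟨k, hk, hck⟩ := isOfFinOrder_iff_pow_eq_one.1 hfin
  obtain ⟨q, hq, hw⟩ := key k
  have hq1 : (Quotient.mk (GenLoop.Homotopic.setoid (Fin 2) x) q : HomotopyGroup.Pi 2 X x) =
      Quotient.mk (GenLoop.Homotopic.setoid (Fin 2) x) GenLoop.const := hq.symm.trans hck
  have h0 : HasWinding (fun s : I × I => Φ ((GenLoop.const : GenLoop (Fin 2) X x) ![s.1, s.2]))
      0 := HasWinding.const (A := Φ x)
  have := HasWinding.eq_of_homotopic hΦ hinv (Quotient.exact hq1) hw h0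
  rcases mul_eq_zero.1 this with h | h
  · exact hk.ne' (by exact_mod_cast h)
  · exact hd h

/-! ### The sign of an invertible Hermitian matrix -/

section Sign

open scoped Matrix.Norms.L2Operator MatrixOrder ComplexOrder

/-- The sign of an invertible Hermitian matrix, i.e. its unitary part in the polar
decomposition. -/
def matrixSign (H : Matrix ι ι ℂ) : Matrix ι ι ℂ := H * (CFC.sqrt (H * H))⁻¹

theorem mul_self_nonneg_of_isHermitian {κ : Type*} [Fintype κ] {H : Matrix κ κ ℂ}
    (hH : H.IsHermitian) : 0 ≤ H * H := by
  rw [Matrix.nonneg_iff_posSemidef]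
  have := Matrix.posSemidef_conjTranspose_mul_self H
  rwa [hH.eq] at this

theorem isUnit_sqrt_mul_self {H : Matrix ι ι ℂ} (hH : H.IsHermitian) (hu : IsUnit H) :
    IsUnit (CFC.sqrt (H * H)) := by
  have h := CFC.sqrt_mul_sqrt_self (H * H) (mul_self_nonneg_of_isHermitian hH)
  have h2 : IsUnit (CFC.sqrt (H * H) * CFC.sqrt (H * H)) := by
    rw [h]
    exact hu.mul hu
  exact isUnit_of_mul_isUnit_left h2

/-- The square root of `H²` is a function of `H²`, hence commutes with `H`; the square of the sign
is therefore `H²` times the inverse of `H²`. -/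
theorem matrixSign_mul_self {H : Matrix ι ι ℂ} (hH : H.IsHermitian) (hu : IsUnit H) :
    matrixSign H * matrixSign H = 1 := by
  have hS := isUnit_sqrt_mul_self hH hu
  have h := CFC.sqrt_mul_sqrt_self (H * H) (mul_self_nonneg_of_isHermitian hH)
  have hc : Commute H (CFC.sqrt (H * H)) := by
    rw [CFC.sqrt_eq_real_sqrt _ (mul_self_nonneg_of_isHermitian hH)]
    refine (Commute.cfcₙ_real ?_ _).symm
    exact (Commute.refl H).mul_left (Commute.refl H)
  have hdet := (Matrix.isUnit_iff_isUnit_det _).1 hS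
  have hc' : (CFC.sqrt (H * H))⁻¹ * H = H * (CFC.sqrt (H * H))⁻¹ := by
    calc (CFC.sqrt (H * H))⁻¹ * H
        = (CFC.sqrt (H * H))⁻¹ * (H * CFC.sqrt (H * H)) * (CFC.sqrt (H * H))⁻¹ := by
          rw [mul_assoc, mul_assoc, Matrix.mul_nonsing_inv _ hdet, mul_one]
      _ = H * (CFC.sqrt (H * H))⁻¹ := by
          rw [hc.eq, ← mul_assoc, Matrix.nonsing_inv_mul _ hdet, one_mul]
  rw [matrixSign, mul_assoc, ← mul_assoc _ H, hc', ← mul_assoc, ← mul_assoc]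
  generalize CFC.sqrt (H * H) = S at *
  rw [← h, mul_assoc S S, Matrix.mul_nonsing_inv _ hdet, mul_one, Matrix.mul_nonsing_inv _ hdet]

theorem continuous_matrixSign {X : Type*} [TopologicalSpace X] {H : X → Matrix ι ι ℂ}
    (hc : Continuous H) (hH : ∀ x, (H x).IsHermitian) (hu : ∀ x, IsUnit (H x)) :
    Continuous fun x => matrixSign (H x) := by
  refine hc.mul (continuous_matrix_inv ?_ fun x => isUnit_sqrt_mul_self (hH x) (hu x))
  exact CFC.continuousOn_sqrt.comp_continuous (hc.mul hc)
    fun x => mul_self_nonneg_of_isHermitian (hH x)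

/-- Here `(S K)² = S²`, so uniqueness of the positive square root identifies it with `S`. This
recognizes the sign from a polar decomposition found by other means. -/
theorem matrixSign_mul {S K : Matrix ι ι ℂ} (hS : S.PosSemidef) (hu : IsUnit S)
    (hSK : S * K = K * S) (hK : K * K = 1) : matrixSign (S * K) = K := by
  have h : CFC.sqrt (S * K * (S * K)) = S :=
    CFC.sqrt_unique (by rw [mul_assoc, ← mul_assoc K, ← hSK, mul_assoc, hK, mul_one])
      (Matrix.nonneg_iff_posSemidef.2 hS)
  rw [matrixSign, h, hSK, mul_assoc, Matrix.mul_nonsing_inv _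
    ((Matrix.isUnit_iff_isUnit_det _).1 hu), mul_one]

end Sign

/-- The determinant of the automorphism that is the scalar `exp l` on the range of an
orthogonal projection and the identity on its kernel. -/
theorem det_exp_smul_projection {P : Matrix ι ι ℂ} (hP : P.IsHermitian) (hPP : P * P = P) (l : ℂ) :
    (Complex.exp l • P + (1 - P)).det = Complex.exp (l * P.trace) := by
  have hs := hP.spectral_theorem
  have hev : ∀ i, hP.eigenvalues i = 0 ∨ hP.eigenvalues i = 1 := by
    intro i
    have h1 := hP.mulVec_eigenvectorBasis i
    have h2 : P.mulVec (P.mulVec (hP.eigenvectorBasis i)) =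
        P.mulVec (hP.eigenvectorBasis i) := by rw [Matrix.mulVec_mulVec, hPP]
    rw [h1, Matrix.mulVec_smul, h1, smul_smul, ← sub_eq_zero, ← sub_smul] at h2
    rcases smul_eq_zero.1 h2 with h | h
    · rcases eq_or_ne (hP.eigenvalues i) 0 with h0 | h0
      · exact Or.inl h0
      · right
        have : hP.eigenvalues i * (hP.eigenvalues i - 1) = 0 := by linear_combination h
        rcases mul_eq_zero.1 this with h | h
        · exact absurd h h0
        · linarith
    · exfalso
      have hn := hP.eigenvectorBasis.orthonormal.ne_zero i
      apply hn
      ext j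
      exact congrFun h j
  set U := hP.eigenvectorUnitary
  have h1 : Complex.exp l • P + (1 - P) = Unitary.conjStarAlgAut ℂ (Matrix ι ι ℂ) U
      (Matrix.diagonal fun i => Complex.exp (l * hP.eigenvalues i)) := by
    -- For an eigenvalue `μ` equal to `0` or `1`, `exp (l μ) = exp l · μ + (1 - μ)`.
    have hd : (Matrix.diagonal fun i => Complex.exp (l * hP.eigenvalues i)) =
        Complex.exp l • Matrix.diagonal (RCLike.ofReal ∘ hP.eigenvalues : ι → ℂ) +
          (1 - Matrix.diagonal (RCLike.ofReal ∘ hP.eigenvalues : ι → ℂ)) := by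
      rw [← Matrix.diagonal_one, Matrix.diagonal_sub, ← Matrix.diagonal_smul,
        Matrix.diagonal_add]
      congr 1
      ext i
      rcases hev i with h | h <;> simp [h]
    rw [hd, map_add, map_sub, map_smul, map_one, ← hs]
  rw [h1, Unitary.conjStarAlgAut_apply, Matrix.det_mul_right_comm, Matrix.det_mul,
    ← Matrix.det_mul, hP.trace_eq_sum_eigenvalues]
  simp [Matrix.det_diagonal, ← Complex.exp_sum, Finset.mul_sum]

end HomotopyGroup

/-! ### The linear contact condition -/

section Wedge

variable {V : Type*} [AddCommGroup V] [Module ℝ V] {m : ℕ}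

/-- Each slot occurs in exactly one factor: slot `0` in `a`, and slots `2i+1`, `2i+2` as the two
arguments of the `i`-th copy of `Ω`. Both multilinearity axioms of `tensorPow` follow from this. -/
theorem exists_linear_update (a : V →ₗ[ℝ] ℝ) (Ω : V →ₗ[ℝ] V →ₗ[ℝ] ℝ)
    (v : Fin (2 * m + 1) → V) (j : Fin (2 * m + 1)) : ∃ f : V →ₗ[ℝ] ℝ, ∀ x,
      a (Function.update v j x ⟨0, by omega⟩) * ∏ i : Fin m,
        Ω (Function.update v j x ⟨2 * i + 1, by omega⟩)
          (Function.update v j x ⟨2 * i + 2, by omega⟩) = f x := by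
  obtain ⟨j, hj⟩ := j
  have hne : ∀ k (hk : k < 2 * m + 1), k ≠ j → ∀ x, Function.update v ⟨j, hj⟩ x ⟨k, hk⟩ =
      v ⟨k, hk⟩ := fun k hk h x => Function.update_of_ne (by simpa using h) _ _
  rcases Nat.eq_zero_or_pos j with rfl | hpos
  · refine ⟨(∏ i : Fin m, Ω (v ⟨2 * i + 1, by omega⟩) (v ⟨2 * i + 2, by omega⟩)) • a,
      fun x => ?_⟩
    rw [Function.update_self, LinearMap.smul_apply, smul_eq_mul, mul_comm]
    congr 1
  · obtain ⟨i, hi⟩ : ∃ i : Fin m, j = 2 * i + 1 ∨ j = 2 * i + 2 :=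
      ⟨⟨(j - 1) / 2, by omega⟩, by simp only; omega⟩
    let R : ℝ := a (v ⟨0, by omega⟩) * ∏ k ∈ Finset.univ.erase i,
      Ω (v ⟨2 * k + 1, by omega⟩) (v ⟨2 * k + 2, by omega⟩)
    have hR : ∀ x, a (Function.update v ⟨j, hj⟩ x ⟨0, by omega⟩) * ∏ i : Fin m,
        Ω (Function.update v ⟨j, hj⟩ x ⟨2 * i + 1, by omega⟩)
          (Function.update v ⟨j, hj⟩ x ⟨2 * i + 2, by omega⟩) =
        R * Ω (Function.update v ⟨j, hj⟩ x ⟨2 * i + 1, by omega⟩)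
          (Function.update v ⟨j, hj⟩ x ⟨2 * i + 2, by omega⟩) := by
      intro x
      rw [← Finset.mul_prod_erase _ _ (Finset.mem_univ i), hne 0 _ hpos.ne]
      have : ∏ k ∈ Finset.univ.erase i,
          Ω (Function.update v ⟨j, hj⟩ x ⟨2 * k + 1, by omega⟩)
            (Function.update v ⟨j, hj⟩ x ⟨2 * k + 2, by omega⟩) =
          ∏ k ∈ Finset.univ.erase i, Ω (v ⟨2 * k + 1, by omega⟩) (v ⟨2 * k + 2, by omega⟩) := by
        refine Finset.prod_congr rfl fun k hk => ?_
        have hki : (k : ℕ) ≠ i := fun h => (Finset.mem_erase.1 hk).1 (Fin.ext h)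
        rw [hne _ _ (by omega), hne _ _ (by omega)]
      rw [this]
      simp only [R]
      ring
    rcases hi with rfl | rfl
    · refine ⟨R • Ω.flip (v ⟨2 * i + 2, by omega⟩), fun x => ?_⟩
      rw [hR, Function.update_self, hne _ _ (by omega)]
      simp
    · refine ⟨R • Ω (v ⟨2 * i + 1, by omega⟩), fun x => ?_⟩
      rw [hR, Function.update_self, hne _ _ (by omega)]
      simp

/-- The multilinear map `a ⊗ Ω ⊗ ⋯ ⊗ Ω`. -/
def tensorPow (m : ℕ) (a : V →ₗ[ℝ] ℝ) (Ω : V →ₗ[ℝ] V →ₗ[ℝ] ℝ) :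
    MultilinearMap ℝ (fun _ : Fin (2 * m + 1) => V) ℝ where
  toFun v := a (v ⟨0, by omega⟩) *
    ∏ i : Fin m, Ω (v ⟨2 * i + 1, by omega⟩) (v ⟨2 * i + 2, by omega⟩)
  map_update_add' {inst} v j x y := by
    obtain rfl : inst = instDecidableEqFin _ := Subsingleton.elim _ _
    obtain ⟨f, hf⟩ := exists_linear_update a Ω v j
    rw [hf, hf, hf, map_add]
  map_update_smul' {inst} v j c x := by
    obtain rfl : inst = instDecidableEqFin _ := Subsingleton.elim _ _
    obtain ⟨f, hf⟩ := exists_linear_update a Ω v j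
    rw [hf, hf, map_smul]

theorem wedgePow_eq_alternatization (a : V →ₗ[ℝ] ℝ) (Ω : V →ₗ[ℝ] V →ₗ[ℝ] ℝ)
    (v : Fin (2 * m + 1) → V) :
    wedgePow m a (fun x y => Ω x y) v = MultilinearMap.alternatization (tensorPow m a Ω) v := by
  rw [MultilinearMap.alternatization_apply, wedgePow]
  refine Finset.sum_congr rfl fun s _ => ?_
  rw [Units.smul_def, zsmul_eq_mul]
  rfl

theorem exists_basis_adapted [FiniteDimensional ℝ V] (hdim : Module.finrank ℝ V = 2 * m + 1)
    {a : V →ₗ[ℝ] ℝ} (ha : a ≠ 0) {u : V} (hu : u ≠ 0) (hau : a u = 0) :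
    ∃ b : Module.Basis (Fin (2 * m + 1)) ℝ V, (∀ i, i ≠ 0 → a (b i) = 0) ∧
      ∃ j, j ≠ 0 ∧ b j = u := by
  obtain ⟨y, hy⟩ : ∃ y, a y ≠ 0 := by
    by_contra! h
    exact ha (LinearMap.ext h)
  have hker : Module.finrank ℝ (LinearMap.ker a) = 2 * m := by
    have h1 := LinearMap.finrank_range_add_finrank_ker a
    have h2 : LinearMap.range a = ⊤ := LinearMap.range_eq_top.2 (LinearMap.surjective ha)
    rw [h2, finrank_top, Module.finrank_self] at h1
    omega
  let u' : LinearMap.ker a := ⟨u, hau⟩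
  have hu' : LinearIndepOn ℝ id ({u'} : Set (LinearMap.ker a)) := by
    refine LinearIndepOn.singleton ?_
    simpa [u', Subtype.ext_iff] using hu
  let b₀ := Module.Basis.extend hu'
  have : Fintype (hu'.extend (Set.subset_univ _)) := FiniteDimensional.fintypeBasisIndex b₀
  let e : hu'.extend (Set.subset_univ _) ≃ Fin (2 * m) :=
    Fintype.equivFinOfCardEq (by rw [← Module.finrank_eq_card_basis b₀, hker])
  let b := Module.Basis.mkFinCons y (b₀.reindex e)
    (fun c x hx h => by
      have h1 := congrArg a h
      rw [map_add, map_smul, LinearMap.mem_ker.1 hx, map_zero, add_zero, smul_eq_mul] at h1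
      exact (mul_eq_zero.1 h1).resolve_right hy)
    (fun z => ⟨-(a z / a y), by
      rw [LinearMap.mem_ker, map_add, map_smul, smul_eq_mul]
      field_simp
      ring⟩)
  have hb : ∀ i : Fin (2 * m), b i.succ = (b₀.reindex e i : V) := fun i => by
    simp [b, Module.Basis.coe_mkFinCons]
  refine ⟨b, fun i hi => ?_, (e ⟨u', hu'.subset_extend _ rfl⟩).succ, Fin.succ_ne_zero _, ?_⟩
  · obtain ⟨k, rfl⟩ := Fin.exists_succ_eq.2 hi
    rw [hb]
    exact (b₀.reindex e k).2
  · rw [hb]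
    simp [b₀, u']

/-- If `a ∧ Ω^m ≠ 0` on a space of dimension `2m+1`, then `Ω` is nondegenerate on `ker a`. -/
theorem eq_zero_of_wedgePow_ne_zero [FiniteDimensional ℝ V]
    (hdim : Module.finrank ℝ V = 2 * m + 1) {a : V →ₗ[ℝ] ℝ} {Ω : V →ₗ[ℝ] V →ₗ[ℝ] ℝ}
    {v : Fin (2 * m + 1) → V} (hv : wedgePow m a (fun x y => Ω x y) v ≠ 0)
    {u : V} (hau : a u = 0) (hΩ : ∀ w, a w = 0 → Ω u w = 0) (hΩ' : ∀ w, a w = 0 → Ω w u = 0) :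
    u = 0 := by
  by_contra hu
  have ha : a ≠ 0 := by
    rintro rfl
    exact hv (by simp [wedgePow])
  obtain ⟨b, hb, j, hj, rfl⟩ := exists_basis_adapted hdim ha hu hau
  apply hv
  rw [wedgePow_eq_alternatization]
  suffices MultilinearMap.alternatization (tensorPow m a Ω) = 0 by simp [this]
  rw [← AlternatingMap.map_basis_eq_zero_iff b, ← wedgePow_eq_alternatization]
  refine Finset.sum_eq_zero fun s _ => ?_
  -- Only `b 0` may lie outside `ker a`. If `a` receives it, then `u = b j` is paired by some `Ω`
  -- with another vector of `ker a`, which gives zero; otherwise the factor `a` itself is zero.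
  by_cases hs : s ⟨0, by omega⟩ = 0
  · have hs' : ∀ k (hk : k < 2 * m + 1), k ≠ 0 → s ⟨k, hk⟩ ≠ 0 := fun k hk hk0 h =>
      hk0 (by simpa using s.injective (h.trans hs.symm))
    obtain ⟨⟨k, hk⟩, rfl⟩ := s.surjective j
    have hk0 : k ≠ 0 := by
      rintro rfl
      exact hj hs
    obtain ⟨i, hi⟩ : ∃ i : Fin m, k = 2 * i + 1 ∨ k = 2 * i + 2 :=
      ⟨⟨(k - 1) / 2, by omega⟩, by simp only; omega⟩
    rw [Finset.prod_eq_zero (Finset.mem_univ i), mul_zero, mul_zero]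
    rcases hi with rfl | rfl
    · exact hΩ _ (hb _ (hs' _ _ (by omega)))
    · exact hΩ' _ (hb _ (hs' _ _ (by omega)))
  · rw [hb _ hs, zero_mul, mul_zero]

end Wedge

/-! ### Stabilization of linear contact structures -/

/-- A splitting `Q = V ⊕ ℝe` of a Euclidean space. -/
structure Splitting (V Q : Type*) [NormedAddCommGroup V] [NormedSpace ℝ V]
    [NormedAddCommGroup Q] [InnerProductSpace ℝ Q] where
  e : Q
  pr : Q →L[ℝ] V
  inc : V →L[ℝ] Q
  inner_e_e : inner ℝ e e = 1
  pr_e : pr e = 0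
  pr_inc : ∀ v, pr (inc v) = v
  inc_pr : ∀ w, inc (pr w) + inner ℝ e w • e = w

namespace Splitting

variable {V Q : Type*} [NormedAddCommGroup V] [NormedSpace ℝ V] [NormedAddCommGroup Q]
  [InnerProductSpace ℝ Q] (D : Splitting V Q)

/-- Orthogonality is not a field of the structure. It follows by decomposing `inc v`, whose
`V`-component is already `v`. -/
theorem inner_e_inc (v : V) : inner ℝ D.e (D.inc v) = 0 := by
  have h := D.inc_pr (D.inc v)
  rw [D.pr_inc] at h
  have h2 : (inner ℝ D.e (D.inc v) : ℝ) • D.e = 0 := by simpa using h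
  rcases smul_eq_zero.1 h2 with h | h
  · exact h
  · rw [h, inner_zero_left]

variable [FiniteDimensional ℝ Q]

/-- The vector of `Q` dual to a linear form on `V`. -/
def dual (a : V →L[ℝ] ℝ) : Q := (InnerProductSpace.toDual ℝ Q).symm (a.comp D.pr)

theorem inner_dual (a : V →L[ℝ] ℝ) (w : Q) : inner ℝ (D.dual a) w = a (D.pr w) := by
  simp [dual]

theorem dual_ne_zero {a : V →L[ℝ] ℝ} (ha : a ≠ 0) : D.dual a ≠ 0 := by
  intro h
  apply ha
  ext v
  have := D.inner_dual a (D.inc v)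
  rw [h, inner_zero_left, D.pr_inc] at this
  simpa using this.symm

theorem dual_smul (c : ℝ) (a : V →L[ℝ] ℝ) : D.dual (c • a) = c • D.dual a := by
  refine ext_inner_right ℝ fun w => ?_
  rw [inner_dual, inner_smul_left, inner_dual]
  simp

/-- The unit vector dual to a linear form on `V`. -/
def normal (a : V →L[ℝ] ℝ) : Q := ‖D.dual a‖⁻¹ • D.dual a

theorem inner_normal (a : V →L[ℝ] ℝ) (w : Q) :
    inner ℝ (D.normal a) w = ‖D.dual a‖⁻¹ * a (D.pr w) := by
  rw [normal, real_inner_smul_left, inner_dual]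

theorem inner_normal_self {a : V →L[ℝ] ℝ} (ha : a ≠ 0) :
    inner ℝ (D.normal a) (D.normal a) = 1 := by
  have := norm_ne_zero_iff.2 (D.dual_ne_zero ha)
  rw [normal, real_inner_smul_left, real_inner_smul_right, real_inner_self_eq_norm_sq]
  field_simp

theorem inner_normal_e (a : V →L[ℝ] ℝ) : inner ℝ (D.normal a) D.e = 0 := by
  rw [inner_normal, D.pr_e, map_zero, mul_zero]

theorem normal_smul {c : ℝ} (hc : 0 < c) (a : V →L[ℝ] ℝ) : D.normal (c • a) = D.normal a := by
  rw [normal, dual_smul, norm_smul, Real.norm_of_nonneg hc.le, smul_smul, normal]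
  congr 1
  field_simp

/-- The projection of `Q` onto `ker a`. -/
def proj (a : V →L[ℝ] ℝ) (w : Q) : V := D.pr (w - inner ℝ (D.normal a) w • D.normal a)

theorem map_proj {a : V →L[ℝ] ℝ} (ha : a ≠ 0) (w : Q) : a (D.proj a w) = 0 := by
  have hn := norm_ne_zero_iff.2 (D.dual_ne_zero ha)
  have h : inner ℝ (D.normal a) (w - inner ℝ (D.normal a) w • D.normal a) = 0 := by
    rw [inner_sub_right, real_inner_smul_right, D.inner_normal_self ha, mul_one, sub_self]
  rw [inner_normal] at h
  exact (mul_eq_zero.1 h).resolve_left (inv_ne_zero hn)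

theorem proj_e (a : V →L[ℝ] ℝ) : D.proj a D.e = 0 := by
  rw [proj, inner_normal_e, zero_smul, sub_zero, D.pr_e]

theorem proj_normal {a : V →L[ℝ] ℝ} (ha : a ≠ 0) : D.proj a (D.normal a) = 0 := by
  rw [proj, D.inner_normal_self ha, one_smul, sub_self, map_zero]

theorem proj_inc {a : V →L[ℝ] ℝ} {v : V} (hv : a v = 0) : D.proj a (D.inc v) = v := by
  rw [proj, inner_normal, D.pr_inc, hv, mul_zero, zero_smul, sub_zero, D.pr_inc]

/-- The nondegenerate form `Ω + e^* ∧ a` on `Q = V ⊕ ℝe`, normalized so as to depend only on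
the hyperplane `ker a`, its coorientation, and the conformal class of `Ω` on it. -/
def form (a : V →L[ℝ] ℝ) (Ω : V →L[ℝ] V →L[ℝ] ℝ) : LinearMap.BilinForm ℝ Q :=
  LinearMap.mk₂ ℝ (fun w w' => ‖D.dual a‖⁻¹ * Ω (D.proj a w) (D.proj a w') +
      (inner ℝ D.e w * inner ℝ (D.normal a) w' - inner ℝ D.e w' * inner ℝ (D.normal a) w))
    (fun x y z => by
      simp only [proj, inner_add_right, add_smul, map_sub, map_add, map_smul,
        add_apply, sub_apply,
        smul_apply, smul_eq_mul]
      ring)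
    (fun c x z => by
      simp only [proj, real_inner_smul_right, map_sub, map_smul,
        sub_apply, smul_apply, smul_eq_mul]
      ring)
    (fun x y z => by
      simp only [proj, inner_add_right, add_smul, map_sub, map_add, map_smul,
        smul_eq_mul]
      ring)
    (fun c x z => by
      simp only [proj, real_inner_smul_right, map_sub, map_smul, smul_eq_mul]
      ring)

theorem form_apply (a : V →L[ℝ] ℝ) (Ω : V →L[ℝ] V →L[ℝ] ℝ) (w w' : Q) :
    D.form a Ω w w' = ‖D.dual a‖⁻¹ * Ω (D.proj a w) (D.proj a w') +
      (inner ℝ D.e w * inner ℝ (D.normal a) w' - inner ℝ D.e w' * inner ℝ (D.normal a) w) := rfl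

theorem form_swap (a : V →L[ℝ] ℝ) {Ω : V →L[ℝ] V →L[ℝ] ℝ} (hΩ : ∀ u v, Ω u v = -Ω v u)
    (w w' : Q) : D.form a Ω w w' = -D.form a Ω w' w := by
  rw [form_apply, form_apply, hΩ (D.proj a w)]
  ring

/-- The unit normal and the projection do not change under positive rescaling of `a`, and `Ω` is
evaluated only on `ker a`. The factor `c` it acquires is cancelled by `‖D.dual a‖⁻¹`. This makes the
involution a function of the contact structure rather than of the form. -/
theorem form_congr {a a' : V →L[ℝ] ℝ} (ha : a ≠ 0) {Ω Ω' : V →L[ℝ] V →L[ℝ] ℝ} {c : ℝ} (hc : 0 < c)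
    (haa : a' = c • a) (hΩ : ∀ u v, a u = 0 → a v = 0 → Ω' u v = c * Ω u v) :
    D.form a' Ω' = D.form a Ω := by
  subst haa
  ext w w'
  have hp : ∀ w, D.proj (c • a) w = D.proj a w := fun w => by rw [proj, D.normal_smul hc, proj]
  rw [form_apply, form_apply, D.normal_smul hc, hp, hp,
    hΩ _ _ (D.map_proj ha w) (D.map_proj ha w'), D.dual_smul, norm_smul,
    Real.norm_of_nonneg hc.le]
  field_simp

/-- For `w` in the radical, pairing with `e` kills the normal component, pairing with the normal
kills the `e`-component, and pairing with `ker a` kills the rest by nondegeneracy of `Ω` there. -/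
theorem form_nondegenerate {a : V →L[ℝ] ℝ} (ha : a ≠ 0) {Ω : V →L[ℝ] V →L[ℝ] ℝ}
    (hskew : ∀ u v, Ω u v = -Ω v u)
    (hΩ : ∀ u, a u = 0 → (∀ v, a v = 0 → Ω u v = 0) → u = 0) : (D.form a Ω).Nondegenerate := by
  have hn := norm_ne_zero_iff.2 (D.dual_ne_zero ha)
  have key : ∀ w, (∀ w', D.form a Ω w w' = 0) → w = 0 := by
    intro w hw
    have h1 := hw D.e
    rw [form_apply, D.proj_e, D.inner_normal_e, D.inner_e_e] at h1
    have h1' : inner ℝ (D.normal a) w = 0 := by simpa using h1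
    have h2 := hw (D.normal a)
    rw [form_apply, D.proj_normal ha, D.inner_normal_self ha, h1'] at h2
    have h2' : inner ℝ D.e w = 0 := by simpa using h2
    have hp : D.proj a w = D.pr w := by rw [proj, h1', zero_smul, sub_zero]
    have hpr : D.pr w = 0 := by
      rw [← hp]
      refine hΩ _ (D.map_proj ha w) fun v hv => ?_
      have h3 := hw (D.inc v)
      rw [form_apply, D.proj_inc hv, h1', h2', D.inner_e_inc] at h3
      simpa [hn, D.dual_ne_zero ha] using h3
    rw [← D.inc_pr w, hpr, h2', map_zero, zero_smul, add_zero]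
  refine ⟨key, fun w hw => key w fun w' => ?_⟩
  rw [D.form_swap a hskew, hw, neg_zero]

theorem continuous_form_apply {X : Type*} [TopologicalSpace X] {a : X → V →L[ℝ] ℝ}
    {Ω : X → V →L[ℝ] V →L[ℝ] ℝ} (ha : Continuous a) (hΩ : Continuous Ω) (h0 : ∀ x, a x ≠ 0)
    (w w' : Q) : Continuous fun x => D.form (a x) (Ω x) w w' := by
  have hd : Continuous fun x => D.dual (a x) :=
    (LinearIsometryEquiv.continuous _).comp
      (((ContinuousLinearMap.compL ℝ Q V ℝ).flip D.pr).continuous.comp ha)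
  have hi : Continuous fun x => ‖D.dual (a x)‖⁻¹ :=
    hd.norm.inv₀ fun x => norm_ne_zero_iff.2 (D.dual_ne_zero (h0 x))
  have hn : Continuous fun x => D.normal (a x) := hi.smul hd
  have hp : ∀ w, Continuous fun x => D.proj (a x) w := fun w => by
    unfold proj
    fun_prop
  simp only [form_apply]
  have := hp w
  have := hp w'
  fun_prop

end Splitting

/-! ### Involutions attached to nondegenerate forms -/

section FormInvolution

variable {Q : Type*} [NormedAddCommGroup Q] [InnerProductSpace ℝ Q]
  {ι : Type*} [Fintype ι] [DecidableEq ι] (b : OrthonormalBasis ι ℝ Q)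

/-- The complexified matrix of an endomorphism of a Euclidean space. -/
def complexMatrix : (Q →ₗ[ℝ] Q) →ₐ[ℝ] Matrix ι ι ℂ :=
  Complex.ofRealAm.mapMatrix.comp (LinearMap.toMatrixAlgEquiv b.toBasis).toAlgHom

theorem complexMatrix_apply (f : Q →ₗ[ℝ] Q) :
    complexMatrix b f = (LinearMap.toMatrix b.toBasis b.toBasis f).map (algebraMap ℝ ℂ) := rfl

/-- The Hermitian matrix `i B` of a skew-symmetric form `B`. -/
def hermitianMatrix (B : LinearMap.BilinForm ℝ Q) : Matrix ι ι ℂ :=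
  Complex.I • (LinearMap.BilinForm.toMatrix b.toBasis B).map (algebraMap ℝ ℂ)

theorem hermitianMatrix_isHermitian {B : LinearMap.BilinForm ℝ Q} (hB : ∀ x y, B x y = -B y x) :
    (hermitianMatrix b B).IsHermitian := by
  ext i j
  simp only [hermitianMatrix, Matrix.conjTranspose_apply, Matrix.smul_apply, Matrix.map_apply,
    LinearMap.BilinForm.toMatrix_apply, hB (b.toBasis j) (b.toBasis i)]
  simp

theorem isUnit_hermitianMatrix {B : LinearMap.BilinForm ℝ Q} (hB : B.Nondegenerate) :
    IsUnit (hermitianMatrix b B) := by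
  have h := (LinearMap.BilinForm.nondegenerate_iff_det_ne_zero b.toBasis).1 hB
  rw [Matrix.isUnit_iff_isUnit_det, isUnit_iff_ne_zero, hermitianMatrix, Matrix.det_smul]
  refine mul_ne_zero (pow_ne_zero _ Complex.I_ne_zero) ?_
  have : ((LinearMap.BilinForm.toMatrix b.toBasis B).map (algebraMap ℝ ℂ)).det =
    algebraMap ℝ ℂ (LinearMap.BilinForm.toMatrix b.toBasis B).det := (RingHom.map_det _ _).symm
  rw [this]
  simpa using h

open scoped ComplexOrder in
theorem posSemidef_map_of_posSemidef {S : Matrix ι ι ℝ} (hS : S.PosSemidef) :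
    (S.map (algebraMap ℝ ℂ)).PosSemidef := by
  obtain ⟨C, rfl⟩ : ∃ C : Matrix ι ι ℝ, S = C.conjTranspose * C := by
    open scoped MatrixOrder in
    exact CStarAlgebra.nonneg_iff_eq_star_mul_self.1 (Matrix.nonneg_iff_posSemidef.2 hS)
  rw [Matrix.map_mul]
  have : (C.conjTranspose).map (algebraMap ℝ ℂ) = (C.map (algebraMap ℝ ℂ)).conjTranspose := by
    ext i j
    simp
  rw [this]
  exact Matrix.posSemidef_conjTranspose_mul_self _

/-- If a skew-symmetric form is compatible with an orthogonal complex structure `J`, then `-iJ` is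
the sign of its Hermitian matrix. -/
theorem matrixSign_hermitianMatrix {B : LinearMap.BilinForm ℝ Q} {J : Q →ₗ[ℝ] Q}
    (hskew : ∀ x y, B x y = -B y x) (hJ : ∀ x y, inner ℝ (J x) y = -inner ℝ x (J y))
    (hJJ : J * J = -1) (hBJ : ∀ x y, B (J x) (J y) = B x y) (hpos : ∀ x, x ≠ 0 → 0 < B x (J x)) :
    matrixSign (hermitianMatrix b B) = (-Complex.I) • complexMatrix b J := by
  set A := LinearMap.BilinForm.toMatrix b.toBasis B with hA
  set j := LinearMap.toMatrix b.toBasis b.toBasis J with hj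
  have hjt : j.transpose = -j := by
    ext i k
    simp only [hj, Matrix.transpose_apply, Matrix.neg_apply, LinearMap.toMatrix_apply]
    simp only [OrthonormalBasis.coe_toBasis, OrthonormalBasis.coe_toBasis_repr_apply,
      OrthonormalBasis.repr_apply_apply]
    rw [real_inner_comm, hJ]
  have hjj : j * j = -1 := by
    rw [hj, ← LinearMap.toMatrix_mul, hJJ, map_neg, LinearMap.toMatrix_one]
  have hjAj : j.transpose * A * j = A := by
    rw [hj, hA, ← LinearMap.BilinForm.toMatrix_comp]
    congr 1
    ext x y
    exact hBJ x y
  have hcomm : A * j = j * A := by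
    have := congrArg (· * j) hjAj
    simp only [hjt] at this
    rw [mul_assoc, hjj] at this
    rw [← this]
    simp
  -- `A * j` is the matrix of `B(x, Jy)`, which compatibility makes an inner product.
  have hS : (A * j).PosDef := by
    have hSA : A * j = LinearMap.BilinForm.toMatrix b.toBasis (B.compRight J) := by
      rw [LinearMap.BilinForm.toMatrix_compRight]
    refine Matrix.PosDef.of_dotProduct_mulVec_pos ?_ fun x hx => ?_
    · ext i k
      rw [hSA]
      simp only [Matrix.conjTranspose_apply, LinearMap.BilinForm.toMatrix_apply,
        LinearMap.BilinForm.compRight_apply, star_trivial]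
      have hJJx : ∀ x, J (J x) = -x := fun x => by
        have := LinearMap.congr_fun hJJ x
        simpa using this
      rw [← hBJ, hJJx, hskew]
      simp
    · have h0 : (b.toBasis.equivFun.symm x) ≠ 0 := by simpa using hx
      have h1 := hpos _ h0
      rw [hSA]
      have h2 := LinearMap.BilinForm.dotProduct_toMatrix_mulVec b.toBasis (B.compRight J) x x
      simp only [star_trivial]
      rw [h2]
      exact h1
  -- The polar decomposition `iA = (A j)(-i j)`, from `j² = -1`.
  have hmul : hermitianMatrix b B = (A * j).map (algebraMap ℝ ℂ) *
      ((-Complex.I) • complexMatrix b J) := by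
    rw [Matrix.mul_smul, complexMatrix_apply, ← hj, ← Matrix.map_mul, mul_assoc, hjj,
      hermitianMatrix, ← hA]
    ext i k
    simp
  rw [hmul]
  apply matrixSign_mul
  · exact posSemidef_map_of_posSemidef hS.posSemidef
  · rw [Matrix.isUnit_iff_isUnit_det]
    have : ((A * j).map (algebraMap ℝ ℂ)).det = algebraMap ℝ ℂ (A * j).det :=
      (RingHom.map_det _ _).symm
    rw [this]
    exact (((Matrix.isUnit_iff_isUnit_det _).1 hS.isUnit)).map (algebraMap ℝ ℂ)
  · rw [Matrix.mul_smul, Matrix.smul_mul, complexMatrix_apply, ← hj, ← Matrix.map_mul,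
      ← Matrix.map_mul, ← mul_assoc, hcomm, mul_assoc]
  · rw [Matrix.mul_smul, Matrix.smul_mul, smul_smul, ← map_mul, hJJ]
    simp

end FormInvolution

section PointwiseInvolution

variable {m : ℕ} {M : Type*} [TopologicalSpace M] [ChartedSpace (Model m) M]
  [IsManifold (𝓡 (2 * m + 1)) ∞ M]

/-! ### The 1-jet of a contact form at a point -/

/-- A single point of the chart target is a compact set, so uniform convergence on compacts controls
the value there. -/
theorem continuous_iteratedFDeriv_localForm (q : M) (k : ℕ) :
    Continuous fun α : ContactForm m M => iteratedFDeriv ℝ k (localForm α.toFun q)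
      (extChartAt (𝓡 (2 * m + 1)) q q) := by
  have h1 : Continuous (fun α : ContactForm m M => UniformOnFun.ofFun
      {K : Set (Model m) | IsCompact K ∧ K ⊆ (extChartAt (𝓡 (2 * m + 1)) q).target}
      (iteratedFDeriv ℝ k (localForm α.toFun q))) :=
    continuous_iff_le_induced.2 ((iInf_le _ q).trans (iInf_le _ k))
  have h2 := (UniformOnFun.uniformContinuous_eval_of_mem
    (β := ContinuousMultilinearMap ℝ (fun _ : Fin k => Model m) (Model m →L[ℝ] ℝ))
    {K : Set (Model m) | IsCompact K ∧ K ⊆ (extChartAt (𝓡 (2 * m + 1)) q).target}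
    (x := extChartAt (𝓡 (2 * m + 1)) q q) (Set.mem_singleton _)
    ⟨isCompact_singleton, by simp⟩).continuous
  exact h2.comp h1

theorem continuous_localForm (q : M) :
    Continuous fun α : ContactForm m M => localForm α.toFun q
      (extChartAt (𝓡 (2 * m + 1)) q q) := by
  have h := (continuous_iteratedFDeriv_localForm (m := m) q 0)
  have h2 : (fun α : ContactForm m M => localForm α.toFun q (extChartAt (𝓡 (2 * m + 1)) q q)) =
    fun α : ContactForm m M => continuousMultilinearCurryFin0 ℝ (Model m) (Model m →L[ℝ] ℝ)
      (iteratedFDeriv ℝ 0 (localForm α.toFun q) (extChartAt (𝓡 (2 * m + 1)) q q)) := by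
    ext1 α
    simp [iteratedFDeriv_zero_eq_comp]
  rw [h2]
  exact (LinearIsometryEquiv.continuous _).comp h

theorem continuous_fderiv_localForm (q : M) :
    Continuous fun α : ContactForm m M => fderiv ℝ (localForm α.toFun q)
      (extChartAt (𝓡 (2 * m + 1)) q q) := by
  have h := (continuous_iteratedFDeriv_localForm (m := m) q 1)
  have h2 : (fun α : ContactForm m M => fderiv ℝ (localForm α.toFun q)
      (extChartAt (𝓡 (2 * m + 1)) q q)) =
    fun α : ContactForm m M => continuousMultilinearCurryFin1 ℝ (Model m) (Model m →L[ℝ] ℝ)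
      (iteratedFDeriv ℝ 1 (localForm α.toFun q) (extChartAt (𝓡 (2 * m + 1)) q q)) := by
    ext1 α
    ext v
    simp [iteratedFDeriv_one_apply]
  rw [h2]
  exact (LinearIsometryEquiv.continuous _).comp h

theorem localForm_extChartAt_apply (α : ContactForm m M) (q : M) (v : Model m) :
    localForm α.toFun q (extChartAt (𝓡 (2 * m + 1)) q q) v = α.toFun q v := by
  have : IsManifold (𝓡 (2 * m + 1)) 1 M := IsManifold.of_le (n := ∞) (by simp)
  have h : mfderiv 𝓘(ℝ, Model m) (𝓡 (2 * m + 1)) (extChartAt (𝓡 (2 * m + 1)) q).symm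
      (extChartAt (𝓡 (2 * m + 1)) q q) v = v := by
    have h1 : mfderivWithin 𝓘(ℝ, Model m) (𝓡 (2 * m + 1)) (extChartAt (𝓡 (2 * m + 1)) q).symm
        (Set.range (𝓡 (2 * m + 1))) (extChartAt (𝓡 (2 * m + 1)) q q) =
        ContinuousLinearMap.id ℝ _ := mfderivWithin_range_extChartAt_symm
    rw [ModelWithCorners.range_eq_univ, mfderivWithin_univ] at h1
    exact DFunLike.congr_fun h1 v
  -- All tangent spaces are the same model space, so the base point can be replaced without
  -- transporting the vector.
  have hx : ∀ x, x = q → ∀ w : Model m, α.toFun x w = α.toFun q w := by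
    rintro x rfl w
    rfl
  rw [localForm]
  refine (hx _ (extChartAt_to_inv q) _).trans ?_
  exact congrArg (α.toFun q) h

theorem dForm_eq (α : ContactForm m M) (q : M) (u v : Model m) :
    dForm α.toFun q u v =
      fderiv ℝ (localForm α.toFun q) (extChartAt (𝓡 (2 * m + 1)) q q) u v -
        fderiv ℝ (localForm α.toFun q) (extChartAt (𝓡 (2 * m + 1)) q q) v u := by
  have : IsManifold (𝓡 (2 * m + 1)) 1 M := IsManifold.of_le (n := ∞) (by simp)
  have h : ∀ v : Model m, mfderiv (𝓡 (2 * m + 1)) 𝓘(ℝ, Model m)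
      (extChartAt (𝓡 (2 * m + 1)) q) q v = v :=
    fun v => DFunLike.congr_fun (show mfderiv (𝓡 (2 * m + 1)) 𝓘(ℝ, Model m)
      (extChartAt (𝓡 (2 * m + 1)) q) q = ContinuousLinearMap.id ℝ _ from
        mfderiv_extChartAt_self) v
  simp only [dForm]
  rw [h, h]

/-- Smoothness of the section is stated in the bundle trivialization at `q`. Over the chart, the
tangent trivialization is inverted by the derivative of the inverse chart, so the coordinate
expression there is `localForm`. -/
theorem differentiableAt_localForm (α : ContactForm m M) (q : M) :
    DifferentiableAt ℝ (localForm α.toFun q) (extChartAt (𝓡 (2 * m + 1)) q q) := by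
  have : IsManifold (𝓡 (2 * m + 1)) 1 M := IsManifold.of_le (n := ∞) (by simp)
  have h := ((contMDiffAt_hom_bundle (E₁ := (TangentSpace (𝓡 (2 * m + 1)) : M → Type _))
    (E₂ := Bundle.Trivial M ℝ) _).1 (α.smooth.contMDiffAt (x := q))).2
  rw [contMDiffAt_iff_source, ModelWithCorners.range_eq_univ, contMDiffWithinAt_univ,
    contMDiffAt_iff_contDiffAt] at h
  refine (h.differentiableAt (by simp)).congr_of_eventuallyEq ?_
  filter_upwards [(extChartAt_target_mem_nhds q :
    (extChartAt (𝓡 (2 * m + 1)) q).target ∈ _)] with y hy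
  have hs : (extChartAt (𝓡 (2 * m + 1)) q).symm y ∈ (chartAt (Model m) q).source := by
    have := (extChartAt (𝓡 (2 * m + 1)) q).map_target hy
    rwa [extChartAt_source] at this
  have h1 : (trivializationAt (Model m) (TangentSpace (𝓡 (2 * m + 1))) q).symmL ℝ
      ((extChartAt (𝓡 (2 * m + 1)) q).symm y) = _ := TangentBundle.symmL_trivializationAt hs
  rw [ModelWithCorners.range_eq_univ, mfderivWithin_univ,
    (extChartAt (𝓡 (2 * m + 1)) q).right_inv hy] at h1
  ext v
  simp only [localForm, Function.comp_apply, ContinuousLinearMap.inCoordinates]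
  erw [h1]
  simp

/-- The exterior derivative at `q`, as a continuous bilinear form. -/
def dFormL (α : ContactForm m M) (q : M) : Model m →L[ℝ] Model m →L[ℝ] ℝ :=
  fderiv ℝ (localForm α.toFun q) (extChartAt (𝓡 (2 * m + 1)) q q) -
    (fderiv ℝ (localForm α.toFun q) (extChartAt (𝓡 (2 * m + 1)) q q)).flip

theorem dFormL_apply (α : ContactForm m M) (q : M) (u v : Model m) :
    dFormL α q u v = dForm α.toFun q u v := by
  rw [dForm_eq]
  rfl

set_option synthInstance.maxHeartbeats 400000 in
theorem continuous_sub_flip {V : Type*} [NormedAddCommGroup V] [NormedSpace ℝ V] :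
    Continuous fun L : V →L[ℝ] V →L[ℝ] ℝ => L - L.flip :=
  continuous_id.sub (ContinuousLinearMap.flipₗᵢ ℝ V V ℝ).continuous

theorem continuous_dFormL (q : M) : Continuous fun α : ContactForm m M => dFormL α q :=
  continuous_sub_flip.comp (continuous_fderiv_localForm (m := m) q)

theorem dFormL_swap (α : ContactForm m M) (q : M) (u v : Model m) :
    dFormL α q u v = -dFormL α q v u := by
  simp [dFormL]

/-- The value of a contact form at `q`, as a linear form on the model space. -/
def formL (α : ContactForm m M) (q : M) : Model m →L[ℝ] ℝ := α.toFun q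

theorem continuous_formL (q : M) : Continuous fun α : ContactForm m M => formL α q := by
  have : (fun α : ContactForm m M => formL α q) = fun α : ContactForm m M => localForm α.toFun q
      (extChartAt (𝓡 (2 * m + 1)) q q) := by
    ext1 α
    ext v
    exact (localForm_extChartAt_apply α q v).symm
  rw [this]
  exact continuous_localForm q

theorem formL_ne_zero (α : ContactForm m M) (q : M) : formL α q ≠ 0 := by
  obtain ⟨v, hv⟩ := α.contact q
  intro h
  exact hv (by simp [wedgePow, show α.toFun q = 0 from h])

theorem dFormL_nondegenerate (α : ContactForm m M) (q : M) (u : Model m) (hu : formL α q u = 0)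
    (h : ∀ v, formL α q v = 0 → dFormL α q u v = 0) : u = 0 := by
  obtain ⟨v, hv⟩ := α.contact q
  refine eq_zero_of_wedgePow_ne_zero (V := Model m) (m := m) (by simp)
    (a := (formL α q : Model m →ₗ[ℝ] ℝ))
    (Ω := LinearMap.mk₂ ℝ (fun x y => dFormL α q x y) (by simp) (by simp) (by simp) (by simp))
    (v := v) ?_ hu (fun w hw => h w hw) (fun w hw => ?_)
  · have he : (fun x y : Model m => dFormL α q x y) = dForm α.toFun q := by
      ext x y
      exact dFormL_apply α q x y
    simp only [LinearMap.mk₂_apply]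
    rw [he]
    exact hv
  · rw [LinearMap.mk₂_apply, dFormL_swap, h w hw, neg_zero]

/-- Positively proportional contact forms have conformal exterior derivatives on their kernel. -/
theorem exists_smul_of_equiv {α β : ContactForm m M} (h : α ≈ β) (q : M) :
    ∃ c : ℝ, 0 < c ∧ formL β q = c • formL α q ∧
      ∀ u v, formL α q u = 0 → formL α q v = 0 → dFormL β q u v = c * dFormL α q u v := by
  choose c hc e using h
  set y₀ := extChartAt (𝓡 (2 * m + 1)) q q with hy₀
  set f := localForm α.toFun q with hf
  set g := localForm β.toFun q with hg
  set k : Model m → ℝ := fun y => c ((extChartAt (𝓡 (2 * m + 1)) q).symm y) with hk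
  have hgf : ∀ y, g y = k y • f y := fun y => by
    rw [hg, hf, localForm, localForm, e]
    rfl
  have hfd : DifferentiableAt ℝ f y₀ := differentiableAt_localForm α q
  have hgd : DifferentiableAt ℝ g y₀ := differentiableAt_localForm β q
  have hf0 : ∀ v, f y₀ v = formL α q v := localForm_extChartAt_apply α q
  obtain ⟨v₀, hv₀⟩ : ∃ v₀, f y₀ v₀ ≠ 0 := by
    by_contra! h0
    exact formL_ne_zero α q (ContinuousLinearMap.ext fun v => by rw [← hf0, h0]; rfl)
  have hfv : DifferentiableAt ℝ (fun y => f y v₀) y₀ := hfd.clm_apply (differentiableAt_const _)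
  have hgv : DifferentiableAt ℝ (fun y => g y v₀) y₀ := hgd.clm_apply (differentiableAt_const _)
  -- The factor is given only pointwise; near `y₀` it is the quotient of the two forms evaluated on
  -- a fixed vector `v₀`.
  have hkd : DifferentiableAt ℝ k y₀ := by
    refine (hgv.fun_mul (hfv.fun_inv hv₀)).congr_of_eventuallyEq ?_
    filter_upwards [hfv.continuousAt.eventually_ne hv₀] with y hy
    simp only [hgf, smul_apply, smul_eq_mul]
    field_simp
  -- After antisymmetrization this is `d(kα) = k dα + dk ∧ α`, whose last term vanishes on `ker α`.
  have hder : fderiv ℝ g y₀ = k y₀ • fderiv ℝ f y₀ + (fderiv ℝ k y₀).smulRight (f y₀) := by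
    rw [show g = fun y => k y • f y from funext hgf]
    exact fderiv_fun_smul hkd hfd
  refine ⟨k y₀, hc _, ?_, fun u v hu hv => ?_⟩
  · ext v
    have h1 : g y₀ v = formL β q v := localForm_extChartAt_apply β q v
    rw [← h1, hgf]
    simp [hf0]
  · have hu' : f y₀ u = 0 := by rw [hf0, hu]
    have hv' : f y₀ v = 0 := by rw [hf0, hv]
    rw [dFormL_apply, dFormL_apply, dForm_eq, dForm_eq, ← hf, ← hg, ← hy₀, hder]
    simp [hu', hv']
    ring

/-! ### The involution attached to a contact structure at a point -/

section Involution

variable {Q : Type*} [NormedAddCommGroup Q] [InnerProductSpace ℝ Q] [FiniteDimensional ℝ Q]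
  {ι : Type*} [Fintype ι] [DecidableEq ι] (b : OrthonormalBasis ι ℝ Q) (D : Splitting (Model m) Q)
  (q : M)

/-- The involution attached to a contact form at `q`. -/
def formInvolution (α : ContactForm m M) : Matrix ι ι ℂ :=
  matrixSign (hermitianMatrix b (D.form (formL α q) (dFormL α q)))

theorem hermitianMatrix_form_isHermitian (α : ContactForm m M) :
    (hermitianMatrix b (D.form (formL α q) (dFormL α q))).IsHermitian :=
  hermitianMatrix_isHermitian b (D.form_swap _ (dFormL_swap α q))

theorem isUnit_hermitianMatrix_form (α : ContactForm m M) :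
    IsUnit (hermitianMatrix b (D.form (formL α q) (dFormL α q))) :=
  isUnit_hermitianMatrix b (D.form_nondegenerate (formL_ne_zero α q) (dFormL_swap α q)
    (dFormL_nondegenerate α q))

theorem formInvolution_mul_self (α : ContactForm m M) :
    formInvolution b D q α * formInvolution b D q α = 1 :=
  matrixSign_mul_self (hermitianMatrix_form_isHermitian b D q α)
    (isUnit_hermitianMatrix_form b D q α)

theorem continuous_formInvolution :
    Continuous fun α : ContactForm m M => formInvolution b D q α := by
  refine continuous_matrixSign ?_ (hermitianMatrix_form_isHermitian b D q)
    (isUnit_hermitianMatrix_form b D q)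
  refine continuous_pi fun i => continuous_pi fun j => ?_
  simp only [hermitianMatrix, Matrix.smul_apply, Matrix.map_apply,
    LinearMap.BilinForm.toMatrix_apply]
  have := D.continuous_form_apply (continuous_formL (m := m) q) (continuous_dFormL q)
    (fun α => formL_ne_zero α q) (b.toBasis i) (b.toBasis j)
  exact (Complex.continuous_ofReal.comp this).const_smul Complex.I

theorem formInvolution_congr {α β : ContactForm m M} (h : α ≈ β) :
    formInvolution b D q α = formInvolution b D q β := by
  obtain ⟨c, hc, h1, h2⟩ := exists_smul_of_equiv h q
  rw [formInvolution, formInvolution, D.form_congr (formL_ne_zero α q) hc h1 h2]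

/-- The involution attached to a contact structure at `q`. -/
def structureInvolution (ξ : ContactStructure m M) : Matrix ι ι ℂ :=
  Quotient.lift (formInvolution b D q) (fun _ _ h => formInvolution_congr b D q h) ξ

theorem structureInvolution_ker (α : ContactForm m M) :
    structureInvolution b D q α.ker = formInvolution b D q α := rfl

theorem continuous_structureInvolution :
    Continuous (structureInvolution (M := M) b D q) :=
  (continuous_formInvolution b D q).quotient_lift _

theorem structureInvolution_mul_self (ξ : ContactStructure m M) :
    structureInvolution b D q ξ * structureInvolution b D q ξ = 1 := by
  induction ξ using Quotient.inductionOn with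
  | h α => exact formInvolution_mul_self b D q α

end Involution

end PointwiseInvolution

/-! ### The winding of the linear quaternionic sphere -/

section Winding

/-- The quaternion with given coordinates. -/
def quat (a b c d : ℝ) : ℍ[ℝ] := ⟨a, b, c, d⟩

@[simp] theorem quat_re (a b c d : ℝ) : (quat a b c d).re = a := rfl
@[simp] theorem quat_imI (a b c d : ℝ) : (quat a b c d).imI = b := rfl
@[simp] theorem quat_imJ (a b c d : ℝ) : (quat a b c d).imJ = c := rfl
@[simp] theorem quat_imK (a b c d : ℝ) : (quat a b c d).imK = d := rfl

theorem unitIm_eq (z : S2) : unitIm z = quat 0 (z.1 0) (z.1 1) (z.1 2) := rfl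

/-- The embedding of `ℂ` in the quaternions that maps the imaginary unit to `k`. -/
def complexToQuaternion : ℂ →+* ℍ[ℝ] where
  toFun z := quat z.re 0 0 z.im
  map_one' := by ext <;> simp
  map_mul' z w := by ext <;> simp
  map_zero' := by ext <;> simp
  map_add' z w := by ext <;> simp

theorem complexToQuaternion_apply (z : ℂ) : complexToQuaternion z = quat z.re 0 0 z.im := rfl

theorem complexToQuaternion_eq (z : ℂ) :
    complexToQuaternion z = z.re • 1 + z.im • complexToQuaternion Complex.I := by
  ext <;> simp [complexToQuaternion_apply]

theorem continuous_quaternion_mk {X : Type*} [TopologicalSpace X] {a b c d : X → ℝ}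
    (ha : Continuous a) (hb : Continuous b) (hc : Continuous c) (hd : Continuous d) :
    Continuous fun x => quat (a x) (b x) (c x) (d x) := by
  have h : Continuous fun x => !₂[a x, b x, c x, d x] := by
    refine (PiLp.continuous_toLp 2 _).comp (continuous_pi fun i => ?_)
    fin_cases i <;> assumption
  exact (Quaternion.linearIsometryEquivTuple.symm.continuous).comp h

theorem unitIm_northPole : unitIm northPole = complexToQuaternion Complex.I := by
  ext <;> simp [unitIm_eq, northPole, collapseVec, complexToQuaternion_apply]

/-- A quaternion conjugating `k` to the point of the sphere with stereographic coordinates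
`(x/w, y/w)`. -/
def rotor (x y w : ℝ) : ℍ[ℝ] := quat x 0 w y

theorem rotor_intertwines {x y w : ℝ} (h : x ^ 2 + y ^ 2 + w ^ 2 ≠ 0) :
    unitIm ⟨collapseVec x y w, collapseVec_mem h⟩ * rotor x y w =
      rotor x y w * complexToQuaternion Complex.I := by
  ext <;> simp [unitIm_eq, rotor, collapseVec, complexToQuaternion_apply] <;> field_simp <;> ring

/-- A nonvanishing function on the square `[-1,1]²` that is equal to `x + i y` on three sides. -/
def sideExtension (x y : ℝ) : ℂ := ⟨x, y * x ^ 2 - (1 - x ^ 2)⟩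

theorem sideExtension_ne_zero (x y : ℝ) : sideExtension x y ≠ 0 := by
  intro h
  have h1 : x = 0 := congrArg Complex.re h
  have h2 : y * x ^ 2 - (1 - x ^ 2) = 0 := congrArg Complex.im h
  rw [h1] at h2
  norm_num at h2

/-- A continuous logarithm of `(x + i) / (x + i (2x² - 1))`. -/
def sideLog (x : ℝ) : ℂ :=
  Complex.log (x + Complex.I) - Complex.log (Complex.I * sideExtension x 1) + Complex.log Complex.I

theorem I_mul_sideExtension (x : ℝ) : Complex.I * sideExtension x 1 = ⟨1 - 2 * x ^ 2, x⟩ := by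
  apply Complex.ext <;> simp [sideExtension]
  ring

theorem continuous_sideLog : Continuous sideLog := by
  unfold sideLog
  refine (Continuous.sub ?_ ?_).add continuous_const
  · refine Continuous.clog (by fun_prop) fun x => Or.inr ?_
    simp
  -- The factor `i` rotates the curve off the branch cut: `(1 - 2x²) + ix` meets the real axis only
  -- at `1`, for `x = 0`.
  · refine Continuous.clog ?_ fun x => ?_
    · simp_rw [I_mul_sideExtension]
      have : (fun x : ℝ => (⟨1 - 2 * x ^ 2, x⟩ : ℂ)) =
          fun x : ℝ => ((1 - 2 * x ^ 2 : ℝ) : ℂ) + x * Complex.I := by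
        ext1 x
        apply Complex.ext <;> simp [-Complex.ofReal_pow]
      rw [this]
      fun_prop
    · rw [I_mul_sideExtension]
      rcases eq_or_ne x 0 with rfl | hx
      · left; simp
      · right; exact hx

theorem exp_sideLog (x : ℝ) :
    Complex.exp (sideLog x) = (x + Complex.I) / sideExtension x 1 := by
  have h1 : (x : ℂ) + Complex.I ≠ 0 := fun h => by simpa using congrArg Complex.im h
  have h2 := sideExtension_ne_zero x 1
  rw [sideLog, Complex.exp_add, Complex.exp_sub, Complex.exp_log h1,
    Complex.exp_log (mul_ne_zero Complex.I_ne_zero h2), Complex.exp_log Complex.I_ne_zero]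
  field_simp

/-- The imaginary part is `arg (1 + i) - 2 arg (-1 + i) + arg (-1 - i)`, and the quadrants of these
points already force it to be negative. -/
theorem sideLog_one_sub_sideLog_neg_one : sideLog 1 - sideLog (-1) ≠ 0 := by
  intro h
  have him := congrArg Complex.im h
  simp only [sideLog, I_mul_sideExtension, Complex.sub_im, Complex.add_im, Complex.log_im,
    Complex.zero_im] at him
  have e1 : (⟨1 - 2 * 1 ^ 2, 1⟩ : ℂ) = -1 + Complex.I := by apply Complex.ext <;> norm_num
  have e2 : (⟨1 - 2 * (-1) ^ 2, -1⟩ : ℂ) = -1 - Complex.I := by apply Complex.ext <;> norm_num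
  rw [e1, e2] at him
  have h1 : |Complex.arg (1 + Complex.I)| ≤ Real.pi / 2 :=
    Complex.abs_arg_le_pi_div_two_iff.2 (by simp)
  have h2 : 0 ≤ Complex.arg (-1 + Complex.I) := Complex.arg_nonneg_iff.2 (by simp)
  have h3 : Real.pi / 2 < |Complex.arg (-1 + Complex.I)| := by
    by_contra hc
    have := Complex.abs_arg_le_pi_div_two_iff.1 (not_lt.1 hc)
    norm_num at this
  have h4 : Complex.arg (-1 - Complex.I) < 0 := Complex.arg_neg_iff.2 (by simp)
  rw [abs_of_nonneg h2] at h3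
  have h5 := (abs_le.1 h1).2
  push_cast at him
  linarith [Real.pi_pos]

variable {ι : Type*} [Fintype ι] [DecidableEq ι]

theorem projection_mul_self {G : Matrix ι ι ℂ} (hG : G * G = 1) :
    ((1 / 2 : ℂ) • (1 + G)) * ((1 / 2 : ℂ) • (1 + G)) = (1 / 2 : ℂ) • (1 + G) := by
  rw [Matrix.smul_mul, Matrix.mul_smul, smul_smul]
  have : (1 + G) * (1 + G) = (2 : ℂ) • (1 + G) := by
    simp only [mul_add, add_mul, mul_one, one_mul, hG, two_smul]
    abel
  rw [this, smul_smul]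
  norm_num

/-- On the `+1`-eigenspace of `-i R(k)` the matrix `R(k)` acts as `i`, so the image of a complex
number `z` acts as the scalar `z`, and `det_exp_smul_projection` applies. -/
theorem eigenDet_complexToQuaternion (R : ℍ[ℝ] →ₐ[ℝ] Matrix ι ι ℂ)
    (hR : ((-Complex.I) • R (complexToQuaternion Complex.I)).IsHermitian) (l : ℂ) :
    eigenDet ((-Complex.I) • R (complexToQuaternion Complex.I))
      (R (complexToQuaternion (Complex.exp l))) =
    Complex.exp (l * ((1 / 2 : ℂ) •
      (1 + (-Complex.I) • R (complexToQuaternion Complex.I))).trace) := by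
  set K := R (complexToQuaternion Complex.I) with hK
  have hKK : K * K = -1 := by
    rw [hK, ← map_mul, ← map_mul, Complex.I_mul_I, map_neg, map_neg, map_one, map_one]
  have hGG : ((-Complex.I) • K) * ((-Complex.I) • K) = 1 := by
    rw [Matrix.smul_mul, Matrix.mul_smul, smul_smul, hKK]
    simp
  have hP : ((1 / 2 : ℂ) • (1 + (-Complex.I) • K)).IsHermitian := by
    have h1 : (1 + (-Complex.I) • K).IsHermitian := Matrix.isHermitian_one.add hR
    rw [Matrix.IsHermitian, Matrix.conjTranspose_smul, h1.eq]
    simp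
  rw [← det_exp_smul_projection hP (projection_mul_self hGG), eigenDet]
  congr 1
  generalize Complex.exp l = z
  rw [complexToQuaternion_eq, map_add, map_smul, map_smul, map_one, ← hK]
  have hz : (1 + (-Complex.I) • K) * (z.re • (1 : Matrix ι ι ℂ) + z.im • K) =
      z • (1 + (-Complex.I) • K) := by
    have e1 : z.re • (1 : Matrix ι ι ℂ) + z.im • K = (z.re : ℂ) • 1 + (z.im : ℂ) • K := by
      ext i j
      simp
    rw [e1]
    simp only [mul_add, add_mul, Matrix.mul_smul, Matrix.smul_mul, mul_one, one_mul, hKK, smul_neg,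
      smul_smul, smul_add]
    have c1 : z = z.re + z.im * Complex.I := (Complex.re_add_im z).symm
    have c2 : z * -Complex.I = z.re * -Complex.I + z.im := by
      linear_combination (-Complex.I) * c1 - (z.im : ℂ) * Complex.I_mul_I
    rw [c2]
    conv_rhs => enter [1]; rw [c1]
    module
  rw [hz]
  have h2 : (1 : Matrix ι ι ℂ) = (1 / 2 : ℂ) • (1 + 1) := by
    rw [← two_smul ℂ (1 : Matrix ι ι ℂ), smul_smul]; norm_num
  rw [smul_comm z]
  rw [show (1 : Matrix ι ι ℂ) - (1 / 2 : ℂ) • (1 + (-Complex.I) • K) =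
    (1 / 2 : ℂ) • (1 - (-Complex.I) • K) by
      conv_lhs => enter [1]; rw [h2]
      rw [← smul_sub]
      congr 1
      abel, ← smul_add]

/-- The family of involutions attached to the linear quaternionic sphere has nonzero winding. -/
theorem hasWinding_collapse (R : ℍ[ℝ] →ₐ[ℝ] Matrix ι ι ℂ)
    (hR : ((-Complex.I) • R (complexToQuaternion Complex.I)).IsHermitian) :
    HasWinding (fun s : I × I => (-Complex.I) • R (unitIm (collapse ![s.1, s.2])))
      ((sideLog 1 - sideLog (-1)) * ((1 / 2 : ℂ) •
        (1 + (-Complex.I) • R (complexToQuaternion Complex.I))).trace) := by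
  have hRc : Continuous R := R.toLinearMap.continuous_of_finiteDimensional
  let X : I → ℝ := fun s => 2 * s - 1
  have hX : Continuous X := by fun_prop
  let W : I × I → ℝ := fun p => (1 - X p.1 ^ 2) * (1 - X p.2 ^ 2)
  let u : I × I → ℍ[ℝ] := fun p => rotor (X p.1) (X p.2) (W p)
  -- The rotor `u` conjugates `k` to the point of the sphere, but on the boundary it is `x + yk`,
  -- not `1`. Dividing on the right by `c`, which commutes with `k`, preserves the conjugation and
  -- normalizes three sides; the winding of `x + iy` along the boundary is thereby moved to the top
  -- side.
  let c : I × I → ℍ[ℝ] := fun p => complexToQuaternion (sideExtension (X p.1) (X p.2))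
  have hu : Continuous u := by
    refine continuous_quaternion_mk (a := fun p => X p.1) (b := fun _ => 0) (c := W)
      (d := fun p => X p.2) ?_ ?_ ?_ ?_ <;> fun_prop
  have hc : Continuous c := by
    refine continuous_quaternion_mk (a := fun p : I × I => X p.1) (b := fun _ => 0) (c := fun _ => 0)
      (d := fun p : I × I => X p.2 * X p.1 ^ 2 - (1 - X p.1 ^ 2)) ?_ ?_ ?_ ?_ <;> fun_prop
  have hc0 : ∀ p, c p ≠ 0 := fun p =>
    (map_ne_zero complexToQuaternion).2 (sideExtension_ne_zero _ _)
  have hu0 : ∀ p, u p ≠ 0 := by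
    intro p h
    apply collapse_ne (X p.1) (X p.2)
    have h1 : X p.1 = 0 := congrArg QuaternionAlgebra.re h
    have h2 : X p.2 = 0 := congrArg QuaternionAlgebra.imK h
    have h3 : W p = 0 := congrArg QuaternionAlgebra.imJ h
    change X p.1 ^ 2 + X p.2 ^ 2 + (W p) ^ 2 = 0
    rw [h1, h2, h3]
    norm_num
  have hside : ∀ p, W p = 0 → (X p.1 ^ 2 = 1 ∨ X p.2 = -1) → u p = c p := by
    intro p hW h
    simp only [u, c, rotor, complexToQuaternion_apply, sideExtension, hW]
    congr 1
    rcases h with h | h <;> rw [h] <;> ring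
  have h0 : unitIm (collapse ![(0 : I × I).1, (0 : I × I).2]) = complexToQuaternion Complex.I := by
    rw [collapse_boundary _ ⟨0, Or.inl rfl⟩, unitIm_northPole]
  have hone : ∀ p, W p = 0 → (X p.1 ^ 2 = 1 ∨ X p.2 = -1) → R (u p * (c p)⁻¹) = 1 := by
    intro p hW h
    rw [hside p hW h, mul_inv_cancel₀ (hc0 p), map_one]
  have X0 : X 0 = -1 := by simp [X]
  have X1 : X 1 = 1 := by simp [X]; norm_num
  refine ⟨fun p => R (u p * (c p)⁻¹), ⟨?_, ?_, ?_, ?_, ?_, ?_⟩,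
    ⟨fun s => sideLog (X s) * ((1 / 2 : ℂ) •
      (1 + (-Complex.I) • R (complexToQuaternion Complex.I))).trace, ?_⟩, ?_, ?_⟩
  · exact hRc.comp (hu.mul (hc.inv₀ hc0))
  · exact fun p => (isUnit_iff_ne_zero.2 (mul_ne_zero (hu0 p) (inv_ne_zero (hc0 p)))).map R
  · intro p
    simp only [h0]
    rw [Matrix.smul_mul, Matrix.mul_smul, ← map_mul, ← map_mul]
    have h1 : unitIm (collapse ![p.1, p.2]) * u p = u p * complexToQuaternion Complex.I :=
      rotor_intertwines (collapse_ne _ _)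
    have h2 : (c p)⁻¹ * complexToQuaternion Complex.I =
        complexToQuaternion Complex.I * (c p)⁻¹ := by
      simp only [c]
      rw [← map_inv₀, ← map_mul, ← map_mul, mul_comm]
    rw [← mul_assoc, h1, mul_assoc, mul_assoc, h2]
  · exact fun s => hone _ (by simp [W, X0]) (Or.inr X0)
  · exact fun t => hone _ (by simp [W, X0]) (Or.inl (by simp [X0]))
  · exact fun t => hone _ (by simp [W, X1]) (Or.inl (by simp [X1]))
  · exact (continuous_sideLog.comp hX).mul continuous_const
  · intro s
    simp only [ContinuousMap.coe_mk, h0]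
    rw [← eigenDet_complexToQuaternion R hR, exp_sideLog]
    congr 2
    rw [map_div₀, div_eq_mul_inv]
    congr 1
    · simp only [u, rotor, complexToQuaternion_apply, W, X1]
      ext <;> simp
    · simp only [c, X1]
  · simp only [ContinuousMap.coe_mk, X0, X1]
    ring

end Winding

/-! ### The Euclidean space `ℍ^{n+1}` -/

/-- `ℍ^{n+1} = ℍ ⊕ ℍⁿ` with its Euclidean structure. -/
abbrev QuatSpace (n : ℕ) : Type := WithLp 2 (ℍ[ℝ] × PiLp 2 (fun _ : Fin n => ℍ[ℝ]))

theorem quatSpace_inner {n : ℕ} (v w : QuatSpace n) :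
    inner ℝ v w = inner ℝ v.fst w.fst + ∑ i, inner ℝ (v.snd i) (w.snd i) := by
  rw [WithLp.prod_inner_apply, PiLp.inner_apply]
  rfl

theorem quatSpace_ext {n : ℕ} {v w : QuatSpace n} (h1 : v.fst = w.fst)
    (h2 : ∀ i, v.snd i = w.snd i) : v = w := by
  apply WithLp.ofLp_injective
  apply Prod.ext h1
  ext1 i
  exact h2 i

/-- Left multiplication by quaternions on `ℍ^{n+1}`. -/
def leftMul (n : ℕ) : ℍ[ℝ] →ₐ[ℝ] (QuatSpace n →ₗ[ℝ] QuatSpace n) :=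
  AlgHom.ofLinearMap
    { toFun := fun q =>
        { toFun := fun w => WithLp.toLp 2 (q * w.fst, WithLp.toLp 2 fun i => q * w.snd i)
          map_add' := fun v w => quatSpace_ext (by simp [mul_add]) (by simp [mul_add])
          map_smul' := fun c w => quatSpace_ext (by simp) (by simp) }
      map_add' := fun p q => LinearMap.ext fun w =>
        quatSpace_ext (by simp [add_mul]) (by simp [add_mul])
      map_smul' := fun c q => LinearMap.ext fun w => quatSpace_ext (by simp) (by simp) }
    (LinearMap.ext fun w => quatSpace_ext (by simp) (by simp))
    (fun p q => LinearMap.ext fun w => quatSpace_ext (by simp [mul_assoc]) (by simp [mul_assoc]))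

theorem leftMul_fst {n : ℕ} (q : ℍ[ℝ]) (w : QuatSpace n) : (leftMul n q w).fst = q * w.fst := rfl

theorem leftMul_snd {n : ℕ} (q : ℍ[ℝ]) (w : QuatSpace n) (i : Fin n) :
    (leftMul n q w).snd i = q * w.snd i := rfl

theorem quaternion_inner_mul_left (q v w : ℍ[ℝ]) :
    inner ℝ (q * v) w = inner ℝ v (star q * w) := by
  simp only [Quaternion.inner_def]
  simp
  ring

theorem inner_leftMul {n : ℕ} (q : ℍ[ℝ]) (v w : QuatSpace n) :
    inner ℝ (leftMul n q v) w = inner ℝ v (leftMul n (star q) w) := by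
  simp only [quatSpace_inner, leftMul_fst, leftMul_snd, quaternion_inner_mul_left]

theorem star_unitIm (z : S2) : star (unitIm z) = -unitIm z := by
  rw [unitIm_eq]
  ext <;> simp

theorem unitIm_mul_self (z : S2) : unitIm z * unitIm z = -1 := by
  have h := z.2
  rw [mem_sphere_zero_iff_norm, EuclideanSpace.norm_eq, Real.sqrt_eq_one, Fin.sum_univ_three] at h
  simp only [Real.norm_eq_abs, sq_abs] at h
  rw [unitIm_eq]
  ext <;> simp
  · linarith
  all_goals ring

theorem inner_leftMul_unitIm {n : ℕ} (z : S2) (v w : QuatSpace n) :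
    inner ℝ (leftMul n (unitIm z) v) w = -inner ℝ v (leftMul n (unitIm z) w) := by
  rw [inner_leftMul, star_unitIm, map_neg, LinearMap.neg_apply, inner_neg_right]

theorem leftMul_unitIm_leftMul_unitIm {n : ℕ} (z : S2) (w : QuatSpace n) :
    leftMul n (unitIm z) (leftMul n (unitIm z) w) = -w := by
  rw [← Module.End.mul_apply, ← map_mul, unitIm_mul_self]
  simp

/-- The real unit of the first factor of `ℍ^{n+1}`. -/
def realUnit (n : ℕ) : QuatSpace n := WithLp.toLp 2 (1, 0)

theorem inner_realUnit {n : ℕ} (w : QuatSpace n) : inner ℝ (realUnit n) w = w.fst.re := by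
  rw [quatSpace_inner]
  simp [realUnit, Quaternion.inner_def]

/-- The inclusion of `Im ℍ ⊕ ℍⁿ` in `ℍ^{n+1}`. -/
def imInclusion (n : ℕ) : ImH n →ₗ[ℝ] QuatSpace n where
  toFun w := WithLp.toLp 2 (w.1.1, WithLp.toLp 2 w.1.2)
  map_add' v w := quatSpace_ext (by simp) (by simp)
  map_smul' c w := quatSpace_ext (by simp) (by simp)

theorem imInclusion_fst {n : ℕ} (w : ImH n) : (imInclusion n w).fst = w.1.1 := rfl

theorem imInclusion_snd {n : ℕ} (w : ImH n) (i : Fin n) : (imInclusion n w).snd i = w.1.2 i := rfl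

/-- The orthogonal projection of `ℍ^{n+1}` to `Im ℍ ⊕ ℍⁿ`. -/
def imProjection (n : ℕ) : QuatSpace n →ₗ[ℝ] ImH n where
  toFun w := ⟨(w.fst - w.fst.re • 1, fun i => w.snd i), by
    change (w.fst - w.fst.re • (1 : ℍ[ℝ])).re = 0
    simp⟩
  map_add' v w := by
    apply Subtype.ext
    apply Prod.ext
    · simp only [WithLp.add_fst, Quaternion.re_add, add_smul, Submodule.coe_add, Prod.fst_add]
      abel
    · ext1 i
      simp
  map_smul' c w := by
    apply Subtype.ext
    apply Prod.ext
    · simp [smul_sub, smul_smul]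
    · ext1 i
      simp

theorem imProjection_val_fst {n : ℕ} (w : QuatSpace n) :
    (imProjection n w).1.1 = w.fst - w.fst.re • 1 := rfl

theorem imProjection_val_snd {n : ℕ} (w : QuatSpace n) (i : Fin n) :
    (imProjection n w).1.2 i = w.snd i := rfl

/-- The splitting `ℍ^{n+1} = V ⊕ ℝ ∂_r` given by a framing `V ≅ Im ℍ ⊕ ℍⁿ`. -/
def framingSplitting {V : Type*} [NormedAddCommGroup V] [NormedSpace ℝ V] [FiniteDimensional ℝ V]
    {n : ℕ} (τ : V ≃ₗ[ℝ] ImH n) : Splitting V (QuatSpace n) where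
  e := realUnit n
  pr := LinearMap.toContinuousLinearMap (τ.symm.toLinearMap ∘ₗ imProjection n)
  inc := LinearMap.toContinuousLinearMap (imInclusion n ∘ₗ τ.toLinearMap)
  inner_e_e := by rw [inner_realUnit]; simp [realUnit]
  pr_e := by
    have : imProjection n (realUnit n) = 0 := by
      apply Subtype.ext
      apply Prod.ext
      · simp [imProjection_val_fst, realUnit]
      · ext1 i
        rw [imProjection_val_snd]
        simp [realUnit]
    simp [this]
  pr_inc v := by
    have : ∀ w : ImH n, imProjection n (imInclusion n w) = w := fun w => by
      apply Subtype.ext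
      apply Prod.ext
      · rw [imProjection_val_fst, imInclusion_fst, show w.1.1.re = 0 from w.2]
        simp
      · rfl
    simp [this]
  inc_pr w := by
    simp only [LinearMap.coe_toContinuousLinearMap', LinearMap.comp_apply,
      LinearEquiv.coe_coe, LinearEquiv.apply_symm_apply]
    rw [inner_realUnit]
    refine quatSpace_ext ?_ fun i => ?_
    · simp [imInclusion_fst, imProjection_val_fst, realUnit]
    · rw [WithLp.add_snd, PiLp.add_apply, imInclusion_snd, imProjection_val_snd]
      simp [realUnit]

/-! ### Stabilized forms compatible with a member of the linear quaternionic sphere -/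

section Framing

variable {V : Type*} [NormedAddCommGroup V] [NormedSpace ℝ V] [FiniteDimensional ℝ V] {n : ℕ}
  (τ : V ≃ₗ[ℝ] ImH n) {a : V →L[ℝ] ℝ} {z : S2}

theorem framingSplitting_e : (framingSplitting τ).e = realUnit n := rfl

theorem framingSplitting_map_pr {c : ℝ} (ha : ∀ u, a u = c * linearForm n z (τ u))
    (w : QuatSpace n) : a ((framingSplitting τ).pr w) =
      c * inner ℝ (leftMul n (unitIm z) (realUnit n)) w := by
  have h : τ ((framingSplitting τ).pr w) = imProjection n w := by
    simp [framingSplitting]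
  rw [ha, h, linearForm, imProjection_val_fst, quatSpace_inner, leftMul_fst]
  simp only [leftMul_snd]
  simp [realUnit, unitIm_eq, Quaternion.inner_def]

theorem inner_leftMul_unitIm_self {c : ℝ} (w : QuatSpace n) (hc : inner ℝ w w = c) :
    inner ℝ (leftMul n (unitIm z) w) (leftMul n (unitIm z) w) = c := by
  rw [inner_leftMul_unitIm, leftMul_unitIm_leftMul_unitIm, inner_neg_right, neg_neg, hc]

theorem norm_leftMul_unitIm_realUnit : ‖leftMul n (unitIm z) (realUnit n)‖ = 1 := by
  rw [norm_eq_sqrt_real_inner, inner_leftMul_unitIm_self _ rfl, inner_realUnit]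
  simp [realUnit]

theorem framingSplitting_dual {c : ℝ} (ha : ∀ u, a u = c * linearForm n z (τ u)) :
    (framingSplitting τ).dual a = c • leftMul n (unitIm z) (realUnit n) := by
  refine ext_inner_right ℝ fun w => ?_
  rw [Splitting.inner_dual, framingSplitting_map_pr τ ha, real_inner_smul_left]

theorem framingSplitting_normal {c : ℝ} (hc : 0 < c)
    (ha : ∀ u, a u = c * linearForm n z (τ u)) :
    (framingSplitting τ).normal a = leftMul n (unitIm z) (realUnit n) := by
  rw [Splitting.normal, framingSplitting_dual τ ha, norm_smul, norm_leftMul_unitIm_realUnit,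
    Real.norm_of_nonneg hc.le, mul_one, smul_smul, inv_mul_cancel₀ hc.ne', one_smul]

theorem framingSplitting_inc_proj {c : ℝ} (hc : 0 < c)
    (ha : ∀ u, a u = c * linearForm n z (τ u)) (w : QuatSpace n) :
    (framingSplitting τ).inc ((framingSplitting τ).proj a w) =
      w - inner ℝ (leftMul n (unitIm z) (realUnit n)) w • leftMul n (unitIm z) (realUnit n) -
        inner ℝ (realUnit n) w • realUnit n := by
  have h := (framingSplitting τ).inc_pr
    (w - inner ℝ ((framingSplitting τ).normal a) w • (framingSplitting τ).normal a)
  have he : inner ℝ (framingSplitting τ).e ((framingSplitting τ).normal a) = 0 := by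
    rw [real_inner_comm, Splitting.inner_normal_e]
  rw [inner_sub_right, real_inner_smul_right, he, mul_zero, sub_zero,
    framingSplitting_normal τ hc ha, framingSplitting_e] at h
  rw [Splitting.proj, framingSplitting_normal τ hc ha, eq_sub_iff_add_eq]
  exact h

/-- The sign of the Hermitian matrix of a linear contact structure that is compatible with a member
of the linear quaternionic sphere. -/
theorem matrixSign_framing {ι : Type*} [Fintype ι] [DecidableEq ι]
    (b : OrthonormalBasis ι ℝ (QuatSpace n)) {Ω : V →L[ℝ] V →L[ℝ] ℝ} {c : ℝ} (hc : 0 < c)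
    (ha0 : a ≠ 0) (ha : ∀ u, a u = c * linearForm n z (τ u)) (hskew : ∀ u v, Ω u v = -Ω v u)
    {j : V → V} (hj : ∀ u, a u = 0 → (τ (j u)).1 = unitIm z • (τ u).1)
    (hjΩ : ∀ u v, a u = 0 → a v = 0 → Ω (j u) (j v) = Ω u v)
    (hpos : ∀ u, a u = 0 → u ≠ 0 → 0 < Ω u (j u)) :
    matrixSign (hermitianMatrix b ((framingSplitting τ).form a Ω)) =
      (-Complex.I) • complexMatrix b (leftMul n (unitIm z)) := by
  set D := framingSplitting τ with hD
  set L := leftMul n (unitIm z) with hL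
  have hN : D.normal a = L (realUnit n) := framingSplitting_normal τ hc ha
  have hLL : ∀ w, L (L w) = -w := leftMul_unitIm_leftMul_unitIm z
  have hLi : ∀ v w, inner ℝ (L v) w = -inner ℝ v (L w) := inner_leftMul_unitIm z
  have h1 : ∀ w, inner ℝ (L (realUnit n)) (L w) = inner ℝ (realUnit n) w := fun w => by
    rw [hLi, hLL, inner_neg_right, neg_neg]
  have h2 : ∀ w, inner ℝ (realUnit n) (L w) = -inner ℝ (L (realUnit n)) w := fun w => by
    rw [hLi, neg_neg]
  have hinc : ∀ u v, D.inc u = D.inc v → u = v := fun u v h => by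
    rw [← D.pr_inc u, h, D.pr_inc]
  have hincj : ∀ u, a u = 0 → D.inc (j u) = L (D.inc u) := by
    intro u hu
    have h := hj u hu
    refine quatSpace_ext ?_ fun i => ?_
    · exact (congrArg Prod.fst h : (τ (j u)).1.1 = unitIm z * (τ u).1.1)
    · exact (congrFun (congrArg Prod.snd h) i : (τ (j u)).1.2 i = unitIm z * (τ u).1.2 i)
  -- `L` preserves the plane spanned by `∂_r` and `L ∂_r`, so it commutes with the orthogonal
  -- projection off this plane, and it acts as `j` on the complement.
  have hproj : ∀ w, D.proj a (L w) = j (D.proj a w) := by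
    intro w
    apply hinc
    rw [hincj _ (D.map_proj ha0 w), framingSplitting_inc_proj τ hc ha,
      framingSplitting_inc_proj τ hc ha, ← hL, h1, h2]
    simp only [map_sub, map_smul, hLL]
    module
  have hdual : 0 < ‖D.dual a‖⁻¹ := inv_pos.2 (norm_pos_iff.2 (D.dual_ne_zero ha0))
  refine matrixSign_hermitianMatrix b (D.form_swap a hskew) hLi ?_ ?_ ?_
  · ext1 w
    exact hLL w
  · intro v w
    rw [D.form_apply, D.form_apply, hproj, hproj,
      hjΩ _ _ (D.map_proj ha0 v) (D.map_proj ha0 w), hN, framingSplitting_e, h1, h1, h2, h2]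
    ring
  · intro w hw
    -- The form becomes a positive multiple of `Ω(p, j p)`, with `p = D.proj a w`, plus the squares
    -- of the components of `w` along `∂_r` and `L ∂_r`. When `p = 0` one of these components is
    -- nonzero.
    rw [D.form_apply, hproj, hN, framingSplitting_e, h1, h2]
    by_cases hp : D.proj a w = 0
    · have h := framingSplitting_inc_proj τ hc ha w
      rw [← hD, hp, map_zero, ← hL] at h
      have hne : inner ℝ (realUnit n) w ≠ 0 ∨ inner ℝ (L (realUnit n)) w ≠ 0 := by
        by_contra! hcon
        rw [hcon.1, hcon.2, zero_smul, zero_smul, sub_zero, sub_zero] at h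
        exact hw h.symm
      rw [hp]
      simp only [map_zero, zero_apply, mul_zero]
      rcases hne with h | h
      · nlinarith [mul_self_pos.2 h, mul_self_nonneg (inner ℝ (L (realUnit n)) w)]
      · nlinarith [mul_self_pos.2 h, mul_self_nonneg (inner ℝ (realUnit n) w)]
    · have h := mul_pos hdual (hpos _ (D.map_proj ha0 w) hp)
      nlinarith [mul_self_nonneg (inner ℝ (L (realUnit n)) w),
        mul_self_nonneg (inner ℝ (realUnit n) w)]

end Framing

/-! ### The Hermitian structure of the quaternionic representation -/

section Representation

variable {n : ℕ} {ι : Type*} [Fintype ι] [DecidableEq ι] (b : OrthonormalBasis ι ℝ (QuatSpace n))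

theorem isHermitian_neg_I_smul_complexMatrix {J : QuatSpace n →ₗ[ℝ] QuatSpace n}
    (hJ : ∀ x y, inner ℝ (J x) y = -inner ℝ x (J y)) :
    ((-Complex.I) • complexMatrix b J).IsHermitian := by
  ext i k
  simp only [complexMatrix_apply, Matrix.conjTranspose_apply, Matrix.smul_apply, Matrix.map_apply,
    LinearMap.toMatrix_apply, OrthonormalBasis.coe_toBasis,
    OrthonormalBasis.coe_toBasis_repr_apply, OrthonormalBasis.repr_apply_apply]
  rw [real_inner_comm, hJ]
  generalize inner ℝ (b i) (J (b k)) = t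
  simp

/-- A real endomorphism has real trace, so `-i tr J` is purely imaginary and the real part is half
the dimension. -/
theorem trace_projection_ne_zero [Nonempty ι] (J : QuatSpace n →ₗ[ℝ] QuatSpace n) :
    ((1 / 2 : ℂ) • (1 + (-Complex.I) • complexMatrix b J)).trace ≠ 0 := by
  have h : (complexMatrix b J).trace =
      ((LinearMap.toMatrix b.toBasis b.toBasis J).trace : ℂ) := by
    rw [complexMatrix_apply, Matrix.trace, Matrix.trace]
    push_cast
    rfl
  rw [Matrix.trace_smul, Matrix.trace_add, Matrix.trace_smul, Matrix.trace_one, h]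
  refine smul_ne_zero (by norm_num) fun h0 => ?_
  have := congrArg Complex.re h0
  simp at this

end Representation

/-! ### Infinite order of almost-quaternionic spheres -/

theorem ContactSphere.AlmostQuaternionic.not_isOfFinOrder {m : ℕ} {M : Type*} [TopologicalSpace M]
    [ChartedSpace (Model m) M] [IsManifold (𝓡 (2 * m + 1)) ∞ M] {ξ₀ : ContactStructure m M}
    {S : ContactSphere ξ₀} (hS : S.AlmostQuaternionic) :
    ¬ IsOfFinOrder (sphereClass S.toMap) := by
  obtain ⟨j, -, -, hcomp, n, q, τ, hτ⟩ := hS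
  let τ' : Model m ≃ₗ[ℝ] ImH n := τ
  let b := stdOrthonormalBasis ℝ (QuatSpace n)
  have : Nontrivial (QuatSpace n) := ⟨realUnit n, 0, fun h => by
    simpa [realUnit] using congrArg (fun w : QuatSpace n => w.fst.re) h⟩
  have : Nonempty (Fin (Module.finrank ℝ (QuatSpace n))) :=
    Fin.pos_iff_nonempty.1 Module.finrank_pos
  let D := framingSplitting τ'
  let R := (complexMatrix b).comp (leftMul n)
  -- The splitting is built from the framing at `q`, so `e` corresponds to `∂_r` and the sphere maps
  -- exactly to the linear family; no deformation is needed.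
  have key : ∀ z, structureInvolution b D q (S.toMap z).1 = (-Complex.I) • R (unitIm z) := by
    intro z
    obtain ⟨α, hα⟩ : ∃ α : ContactForm m M, α.ker = (S.toMap z).1 := Quotient.exists_rep _
    obtain ⟨⟨c, hc, hc'⟩, hj⟩ := hτ z α hα
    have hC := hcomp z α hα q
    rw [← hα, structureInvolution_ker]
    refine matrixSign_framing τ' b hc (formL_ne_zero α q) hc' (dFormL_swap α q)
      (j := fun u => j z q u) hj (fun u v hu hv => ?_) (fun u hu hu0 => ?_)
    · exact (dFormL_apply α q _ _).trans
        (((hC u hu).2.2.1 v hv).trans (dFormL_apply α q u v).symm)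
    · exact lt_of_lt_of_eq ((hC u hu).2.2.2 hu0) (dFormL_apply α q _ _).symm
  have hH : ((-Complex.I) • R (complexToQuaternion Complex.I)).IsHermitian := by
    rw [← unitIm_northPole]
    exact isHermitian_neg_I_smul_complexMatrix b (inner_leftMul_unitIm _)
  refine HasWinding.not_isOfFinOrder
    (Φ := fun ξ : ContactSpace ξ₀ => structureInvolution b D q ξ.1)
    ((continuous_structureInvolution b D q).comp continuous_subtype_val)
    (fun ξ => structureInvolution_mul_self b D q ξ.1)
    (mul_ne_zero sideLog_one_sub_sideLog_neg_one (trace_projection_ne_zero b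
      (leftMul n (complexToQuaternion Complex.I))))
    ?_ (c := sphereClass S.toMap) rfl
  convert hasWinding_collapse R hH using 2 with s
  · exact key _
  · rfl

end ContactSpheres

end

theorem mainTheorem4 {m : ℕ} {M : Type*} [TopologicalSpace M] [T2Space M]
    [SecondCountableTopology M] [ChartedSpace (ContactSpheres.Model m) M]
    [IsManifold (𝓡 (2 * m + 1)) ∞ M] (ξ₀ : ContactSpheres.ContactStructure m M)
    (S : ContactSpheres.ContactSphere ξ₀) (hS : S.AlmostQuaternionic) :
    ¬ IsOfFinOrder (ContactSpheres.sphereClass S.toMap) := by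
  exact hS.not_isOfFinOrder
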